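/- Let $A$ be a finite alphabet with $|A|\ge 2$. A set $X\subseteq A^*$ is a (variable-length) code if every word of $X^*$ has exactly one factorization into elements of $X$. For a relation $\tau\subseteq A^*\times A^*$ put $\tau(X)=\{w' : (x,w')\in\tau \text{ for some } x\in X\}$, $\underline\tau=\tau\setminus\{(w,w): w\in A^*\}$ and $\hat\tau=\tau\cup\{(w,w): w\in A^*\}$; $X$ is $\tau$-independent if $\tau(X)\cap X=\emptyset$. For $k\ge 1$ define the edit relations: $(w,w')\in\delta_k$ iff $w'$ is a subsequence of $w$ of length $|w|-k$; $\iota_k=\delta_k^{-1}$; $(w,w')\in\sigma_k$ iff $|w|=|w'|$ and $w,w'$ differ in exactly $k$ positions; $\Delta_k=\bigcup_{1\le j\le k}\delta_j$; $I_k=\bigcup_{1\le j\le k}\iota_j$; $S_k=\bigcup_{1\le j\le k}(\delta_1\cup\iota_1)^j$; $\Lambda_k=\bigcup_{1\le j\le k}(\delta_1\cup\iota_1\cup\sigma_1)^j$. Consider the following conditions on a code $X\subseteq A^*$ and a relation $\tau$: (c2) $X$ is $\underline\tau$-independent, that is, $X\cap\underline\tau(X)=\emptyset$; (c3) for all $x,y\in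 X$, $\tau(x)\cap\tau(y)\ne\emptyset$ implies $x=y$; (c4) $X$ is maximal in the family of $\tau$-independent codes, that is, $X$ is a $\tau$-independent code and is not strictly contained in any $\tau$-independent code; (c5) $\hat\tau(X)$ is a code; (c6) $\underline\tau(X)$ is a code. In each statement below, "decidable" means that for each of the listed families of relations there is an algorithm which, given $k\ge 1$ and a finite automaton recognizing a code $X\subseteq A^*$ (subject to the stated restriction on $X$), decides whether the condition holds. (i) For $\tau\in\{\delta_k,\iota_k,\sigma_k,\Delta_k,I_k,\underline{S_k},\underline{\Lambda_k}\}$ and $X$ a finite code, each of the conditions (c2), (c3), (c4), (c5), (c6) is decidable. (ii) For $\tau\in\{\delta_k,\iota_k,\sigma_k,\Delta_k,I_k,\underline{S_k},\underline{\Lambda_k}\}$ and $X$ a regular code, the conditions (c4) and (c5) are decidable. (iii) For $\tau\in\{\delta_k,\iota_k,\sigma_k,\Delta_k,I_k,S_1,\Lambda_1\}$ and $X$ a regular code, the conditions (c2) and (c6) are decidable. -/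

import Mathlib

namespace EditCodes

open InformationTheory

/-- Binary relations on the words over the alphabet `A`. -/
abbrev WordRel (A : Type*) := SetRel (List A) (List A)

namespace WordRel

variable {A : Type*}

/-- `k`-character deletion: `w'` is a subsequence of `w` of length `|w| - k`. -/
def del (k : ℕ) : WordRel A :=
  {p | p.2.Sublist p.1 ∧ p.2.length + k = p.1.length}

/-- `k`-character insertion: the converse of `k`-character deletion. -/
def ins (k : ℕ) : WordRel A := (del k).inv

/-- `k`-character substitution: two words of the same length that differ in exactly `k`
positions. -/
def sub (k : ℕ) : WordRel A :=
  {p | p.1.length = p.2.length ∧ {i : ℕ | p.1[i]? ≠ p.2[i]?}.ncard = k}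

/-- Deletion of at least one and at most `p` characters. -/
def delUpTo (p : ℕ) : WordRel A := ⋃ k ∈ Set.Icc 1 p, del k

/-- Insertion of at least one and at most `p` characters. -/
def insUpTo (p : ℕ) : WordRel A := ⋃ k ∈ Set.Icc 1 p, ins k

/-- The `n`-fold composition of a relation with itself. -/
def pow (τ : WordRel A) : ℕ → WordRel A
  | 0 => SetRel.id
  | n + 1 => (pow τ n).comp τ

/-- The relation `S_p = ⋃_{1 ≤ k ≤ p} (δ₁ ∪ ι₁)^k`. -/
def indel (p : ℕ) : WordRel A := ⋃ k ∈ Set.Icc 1 p, pow (del 1 ∪ ins 1) k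

/-- The relation `Λ_p = ⋃_{1 ≤ k ≤ p} (δ₁ ∪ ι₁ ∪ σ₁)^k`. -/
def lev (p : ℕ) : WordRel A := ⋃ k ∈ Set.Icc 1 p, pow (del 1 ∪ ins 1 ∪ sub 1) k

/-- The antireflexive restriction of a relation. -/
def antirefl (τ : WordRel A) : WordRel A := τ \ SetRel.id

/-- The reflexive closure of a relation. -/
def reflClosure (τ : WordRel A) : WordRel A := τ ∪ SetRel.id

/-- `X` is `τ`-independent: `τ(X) ∩ X = ∅`. -/
def Independent (τ : WordRel A) (X : Set (List A)) : Prop := τ.image X ∩ X = ∅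

/-- The error-correction constraint: `τ(x) ∩ τ(y) ≠ ∅` implies `x = y`, for all `x, y ∈ X`. -/
def ErrorCorrecting (τ : WordRel A) (X : Set (List A)) : Prop :=
  ∀ x ∈ X, ∀ y ∈ X, (τ.image {x} ∩ τ.image {y}).Nonempty → x = y

/-- `X` is maximal in the family of `τ`-independent codes (in particular `X` is a
`τ`-independent code). -/
def MaximalIndependentCode (τ : WordRel A) (X : Set (List A)) : Prop :=
  Maximal (fun Y : Set (List A) => UniquelyDecodable Y ∧ Independent τ Y) X

end WordRel

/-- A finite automaton written down as finite data: the list of its initial states, the list of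
its transitions and the list of its final states. The states are natural numbers. -/
abbrev FinAut (A : Type*) := List ℕ × List (ℕ × A × ℕ) × List ℕ

namespace FinAut

variable {A : Type*}

/-- The nondeterministic automaton described by the data. -/
def toNFA (M : FinAut A) : NFA A ℕ where
  step p a := {q | (p, a, q) ∈ M.2.1}
  start := {q | q ∈ M.1}
  accept := {q | q ∈ M.2.2}

/-- The set of words recognized by the automaton. -/
def lang (M : FinAut A) : Set (List A) := {w | w ∈ M.toNFA.accepts}

/-- An instance of the decision problems: an integer `k ≥ 1` and a regular code, the latter given
by an automaton. -/
def IsCodeInstance (i : ℕ × FinAut A) : Prop := 1 ≤ i.1 ∧ UniquelyDecodable i.2.lang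

/-- An instance whose code is finite. -/
def IsFiniteCodeInstance (i : ℕ × FinAut A) : Prop := IsCodeInstance i ∧ i.2.lang.Finite

/-- Over a finite alphabet, the sets of words described by such data are exactly the regular
ones. -/
theorem isRegular_iff_exists_lang [Finite A] (L : Language A) :
    L.IsRegular ↔ ∃ M : FinAut A, M.lang = L := by
  classical
  constructor
  · rintro ⟨σ, hσ, D, rfl⟩
    have : Fintype A := Fintype.ofFinite A
    obtain ⟨n, ⟨e⟩⟩ := Finite.exists_equiv_fin σ
    obtain ⟨M, hM⟩ : ∃ M : FinAut A, M = ([(e D.start : ℕ)],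
      (Finset.univ : Finset (σ × A)).toList.map
        (fun p => ((e p.1 : ℕ), p.2, (e (D.step p.1 p.2) : ℕ))),
      ((Finset.univ : Finset σ).filter (· ∈ D.accept)).toList.map (fun s => (e s : ℕ))) :=
      ⟨_, rfl⟩
    refine ⟨M, ?_⟩
    have key : ∀ (w : List A) (s : σ),
        M.toNFA.evalFrom {(e s : ℕ)} w = {(e (D.evalFrom s w) : ℕ)} := by
      intro w
      induction w with
      | nil => intro s; simp
      | cons a w ih =>
        intro s
        rw [NFA.evalFrom_cons, NFA.stepSet_singleton]
        have : M.toNFA.step (e s : ℕ) a = {(e (D.step s a) : ℕ)} := by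
          ext q
          simp only [toNFA, hM, Set.mem_ofPred_eq, List.mem_map, Finset.mem_toList,
            Finset.mem_univ, true_and, Prod.mk.injEq, Prod.exists, Set.mem_singleton_iff]
          constructor
          · rintro ⟨s', a', h1, rfl, rfl⟩
            have : s' = s := e.injective (Fin.ext h1)
            rw [this]
          · rintro rfl
            exact ⟨s, a, rfl, rfl, rfl⟩
        rw [this, ih]
        rfl
    ext w
    have hs : M.toNFA.start = {(e D.start : ℕ)} := by
      ext q; simp [toNFA, hM]
    change w ∈ M.toNFA.accepts ↔ w ∈ D.accepts
    rw [NFA.mem_accepts, hs, key, DFA.mem_accepts]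
    simp only [Set.mem_singleton_iff, exists_eq_right, toNFA, hM, Set.mem_ofPred_eq, List.mem_map,
      Finset.mem_toList, Finset.mem_filter, Finset.mem_univ, true_and]
    constructor
    · rintro ⟨s, h1, h2⟩
      have : s = D.evalFrom D.start w := e.injective (Fin.ext h2)
      rw [this] at h1
      exact h1
    · intro h
      exact ⟨_, h, rfl⟩
  · rintro ⟨M, rfl⟩
    refine Language.IsRegular.of_finite_range_leftQuotient ?_
    have hfin : Set.Finite {q : ℕ | q ∈ M.1 ∨ ∃ t ∈ M.2.1, t.2.2 = q} := by
      refine ((M.1.toFinset ∪ (M.2.1.map (fun t => t.2.2)).toFinset).finite_toSet).subset ?_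
      intro q hq
      simpa using hq
    refine ((hfin.finite_subsets).image (fun S => M.toNFA.acceptsFrom S)).subset ?_
    rintro _ ⟨x, rfl⟩
    refine ⟨M.toNFA.evalFrom M.toNFA.start x, ?_, ?_⟩
    · induction x using List.reverseRecOn with
      | nil => intro q hq; exact Or.inl hq
      | append_singleton x a _ =>
        intro q hq
        rw [NFA.evalFrom_append, NFA.evalFrom_singleton, NFA.mem_stepSet] at hq
        obtain ⟨p, -, hp⟩ := hq
        exact Or.inr ⟨(p, a, q), hp, rfl⟩
    · ext y
      exact (NFA.append_mem_acceptsFrom M.toNFA).symm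

end FinAut

/-- The problem `P` is decidable on the instances that satisfy `promise`: some algorithm
answers it correctly on all of them. -/
def DecidableOn {α : Type*} [Primcodable α] (promise P : α → Prop) : Prop :=
  ∃ D : α → Prop, ComputablePred D ∧ ∀ a, promise a → (D a ↔ P a)

end EditCodes

open EditCodes InformationTheory

/-! Once the diagonal is removed, each listed relation has the form `editRel C k`: distinct words
joined by an alignment whose numbers of deletions, insertions and substitutions satisfy a primitive
recursive constraint `C k` with bounded entries. Membership in such a relation is settled by
searching the edit scripts between two words.

A regular language has finitely many left quotients, and a bound on their number can be computed
from the automaton. Such bounds propagate through Boolean operations, the star and images under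
bounded edits (`HasIndex.star`, `HasIndex.image_editRel`). By pumping, a nonempty language of index
at most n contains a word of length below n. So each condition reduces to a search over words of
computable length: independence is emptiness of an intersection, failure of unique decodability is
one overlap between two factorizations (`uniquelyDecodable_iff_bounded`), and a finite code has only
short words.

Maximality quantifies over all larger codes, but for a regular code it amounts to independence
together with completeness, that is, every word being a factor of X* (`maximalIndependentCode_iff`).
If w is not such a factor, an unbordered word with more copies of w than there can be edits may be
added to X. Conversely, a regular code is thin, and a measure argument based on the Kraft-McMillan
inequality shows that a complete thin code is contained in no larger code. -/

namespace EditCodes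

open InformationTheory

/-! ### Languages with boundedly many left quotients, and short witnesses. -/

section Index

variable {A : Type*}

/-- `L` is saturated by a right-compatible map with at most `n` values; equivalently `L` has at
most `n` left quotients. -/
def HasIndex (L : Set (List A)) (n : ℕ) : Prop :=
  ∃ φ : List A → Fin n, ∀ u u' v, φ u = φ u' → u ++ v ∈ L → u' ++ v ∈ L

theorem HasIndex.of_finite {L : Set (List A)} {F : Type*} [Finite F] (φ : List A → F)
    (h : ∀ u u' v, φ u = φ u' → u ++ v ∈ L → u' ++ v ∈ L) : HasIndex L (Nat.card F) :=
  ⟨fun u => Finite.equivFin F (φ u), fun u u' v hu => h u u' v ((Finite.equivFin F).injective hu)⟩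

theorem HasIndex.inter {L K : Set (List A)} {n m : ℕ} (hL : HasIndex L n) (hK : HasIndex K m) :
    HasIndex (L ∩ K) (n * m) := by
  obtain ⟨φ, hφ⟩ := hL
  obtain ⟨ψ, hψ⟩ := hK
  have := HasIndex.of_finite (L := L ∩ K) (fun u => (φ u, ψ u)) (by
    rintro u u' v h ⟨h1, h2⟩
    rw [Prod.mk.injEq] at h
    exact ⟨hφ _ _ _ h.1 h1, hψ _ _ _ h.2 h2⟩)
  simpa using this

theorem HasIndex.union {L K : Set (List A)} {n m : ℕ} (hL : HasIndex L n) (hK : HasIndex K m) :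
    HasIndex (L ∪ K) (n * m) := by
  obtain ⟨φ, hφ⟩ := hL
  obtain ⟨ψ, hψ⟩ := hK
  have := HasIndex.of_finite (L := L ∪ K) (fun u => (φ u, ψ u)) (by
    rintro u u' v h h1
    rw [Prod.mk.injEq] at h
    exact h1.imp (hφ _ _ _ h.1) (hψ _ _ _ h.2))
  simpa using this

theorem HasIndex.compl {L : Set (List A)} {n : ℕ} (hL : HasIndex L n) : HasIndex Lᶜ n := by
  obtain ⟨φ, hφ⟩ := hL
  exact ⟨φ, fun u u' v h h1 h2 => h1 (hφ _ _ _ h.symm h2)⟩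

/-- The left quotient of a language by a word. -/
def residual (L : Set (List A)) (u : List A) : Set (List A) := {v | u ++ v ∈ L}

theorem HasIndex.residual {L : Set (List A)} {n : ℕ} (hL : HasIndex L n) (u : List A) :
    HasIndex (residual L u) n := by
  obtain ⟨φ, hφ⟩ := hL
  refine ⟨fun v => φ (u ++ v), fun v v' w h h1 => ?_⟩
  have := hφ _ _ w h
  simp only [EditCodes.residual, Set.mem_ofPred_eq, List.append_assoc] at this h1 ⊢
  exact this h1

theorem hasIndex_nonempty_words : HasIndex {w : List A | w ≠ []} 2 := by
  have := HasIndex.of_finite (L := {w : List A | w ≠ []}) (fun u => decide (u.length = 0)) (by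
    intro u u' v h h1
    rw [decide_eq_decide] at h
    simp only [List.length_eq_zero_iff] at h
    simp only [Set.mem_ofPred_eq, ne_eq, List.append_eq_nil_iff, not_and_or] at h1 ⊢
    tauto)
  simpa using this

/-- A long word factors so that its first two prefixes have the same class. -/
theorem exists_eq_append_of_length_le {n : ℕ} (φ : List A → Fin n) {w : List A}
    (hw : n ≤ w.length) : ∃ u p v, w = u ++ p ++ v ∧ p ≠ [] ∧ φ u = φ (u ++ p) := by
  obtain ⟨i, j, hij, h⟩ := Fintype.exists_ne_map_eq_of_card_lt
    (fun i : Fin (n + 1) => φ (w.take i)) (by simp)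
  wlog hlt : (i : ℕ) < j generalizing i j
  · exact this j i hij.symm h.symm (by
      have : (i : ℕ) ≠ j := fun h => hij (Fin.ext h)
      omega)
  have e1 : w.take j = w.take i ++ (w.drop i).take (j - i) := by
    rw [← List.take_add]; congr 1; omega
  refine ⟨w.take i, (w.drop i).take (j - i), w.drop j, ?_, ?_, ?_⟩
  · rw [← e1, List.take_append_drop]
  · intro h0
    have := congrArg List.length h0
    simp at this
    have := j.2
    omega
  · rw [← e1]; exact h

/-- In a word of length at least n, the segment between two prefixes of equal class can be removed.
-/
theorem HasIndex.exists_short {L : Set (List A)} {n : ℕ} (hL : HasIndex L n)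
    (h : L.Nonempty) : ∃ w ∈ L, w.length < n := by
  obtain ⟨φ, hφ⟩ := hL
  obtain ⟨w, hw⟩ := h
  induction hl : w.length using Nat.strong_induction_on generalizing w with
  | _ l ih =>
    by_cases hlt : w.length < n
    · exact ⟨w, hw, hlt⟩
    obtain ⟨u, p, v, rfl, hp, h⟩ := exists_eq_append_of_length_le φ (not_lt.1 hlt)
    refine ih (u ++ v).length ?_ (u ++ v) (hφ _ _ _ h.symm hw) rfl
    have := List.length_pos_iff.2 hp
    simp at hl ⊢; omega

/-- If a longest word had length at least n, repeating a pumpable segment would give a longer one.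
-/
theorem HasIndex.length_lt_of_finite {L : Set (List A)} {n : ℕ} (hL : HasIndex L n)
    (hf : L.Finite) {w : List A} (hw : w ∈ L) : w.length < n := by
  obtain ⟨φ, hφ⟩ := hL
  obtain ⟨m, hm, hmax⟩ := Set.exists_max_image L List.length hf ⟨w, hw⟩
  refine (hmax w hw).trans_lt ?_
  by_contra hlt
  obtain ⟨u, p, v, rfl, hp, h⟩ := exists_eq_append_of_length_le φ (not_lt.1 hlt)
  rw [List.append_assoc] at hm
  have h1 := hmax _ (hφ _ _ _ h hm)
  have h2 := List.length_pos_iff.2 hp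
  simp only [List.length_append] at h1
  omega

/-- The submonoid generated by a set of words. -/
def star (Y : Set (List A)) : Set (List A) :=
  {w | ∃ L : List (List A), (∀ x ∈ L, x ∈ Y) ∧ L.flatten = w}

theorem nil_mem_star (Y : Set (List A)) : [] ∈ star Y := ⟨[], by simp⟩

theorem append_mem_star {Y : Set (List A)} {u v : List A} (hu : u ∈ star Y) (hv : v ∈ star Y) :
    u ++ v ∈ star Y := by
  obtain ⟨L, hL, rfl⟩ := hu
  obtain ⟨K, hK, rfl⟩ := hv
  exact ⟨L ++ K, by simpa [or_imp, forall_and] using ⟨hL, hK⟩, by simp⟩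

theorem subset_star (Y : Set (List A)) : Y ⊆ star Y := fun x hx => ⟨[x], by simpa, by simp⟩

/-- The cut between `u` and `v` falls either between two factors or within one. -/
theorem append_mem_star_iff {Y : Set (List A)} {u v : List A} :
    u ++ v ∈ star Y ↔ (u ∈ star Y ∧ v ∈ star Y) ∨
      ∃ u₁ u₂ v₁ v₂, u = u₁ ++ u₂ ∧ v = v₁ ++ v₂ ∧ u₁ ∈ star Y ∧ u₂ ++ v₁ ∈ Y ∧ v₂ ∈ star Y := by
  constructor
  · rintro ⟨L, hL, h⟩
    rcases List.flatten_eq_append_iff.1 h with ⟨as, bs, rfl, rfl, rfl⟩ |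
      ⟨as, bs, c, cs, ds, rfl, rfl, rfl⟩
    · simp only [List.mem_append, or_imp, forall_and] at hL
      exact Or.inl ⟨⟨as, hL.1, rfl⟩, ⟨bs, hL.2, rfl⟩⟩
    · simp only [List.mem_append, List.mem_cons, or_imp, forall_and, forall_eq] at hL
      exact Or.inr ⟨as.flatten, bs, c :: cs, ds.flatten, rfl, rfl, ⟨as, hL.1, rfl⟩, hL.2.1,
        ⟨ds, hL.2.2, rfl⟩⟩
  · rintro (⟨hu, hv⟩ | ⟨u₁, u₂, v₁, v₂, rfl, rfl, h1, h2, h3⟩)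
    · exact append_mem_star hu hv
    · simpa using append_mem_star h1 (append_mem_star (subset_star Y h2) h3)

/-- The class of `u` records the classes of what remains after removing a prefix in the star, which
handles a factor straddling the cut. One further bit tells whether `u` itself lies in the star. -/
theorem HasIndex.star {Y : Set (List A)} {n : ℕ} (hY : HasIndex Y n) :
    HasIndex (star Y) (2 ^ n * 2) := by
  classical
  obtain ⟨φ, hφ⟩ := hY
  have := HasIndex.of_finite (L := EditCodes.star Y)
    (fun u => (({f | ∃ u₁ u₂, u = u₁ ++ u₂ ∧ u₁ ∈ EditCodes.star Y ∧ φ u₂ = f} : Set (Fin n)),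
      decide (u ∈ EditCodes.star Y))) (by
    intro u u' v h h1
    rw [Prod.mk.injEq, decide_eq_decide] at h
    rw [append_mem_star_iff] at h1 ⊢
    rcases h1 with ⟨h1, h2⟩ | ⟨u₁, u₂, v₁, v₂, rfl, rfl, h1, h2, h3⟩
    · exact Or.inl ⟨h.2.1 h1, h2⟩
    · obtain ⟨u₁', u₂', rfl, h4, h5⟩ :=
        (Set.ext_iff.1 h.1 (φ u₂)).1 ⟨u₁, u₂, rfl, h1, rfl⟩
      exact Or.inr ⟨u₁', u₂', v₁, v₂, rfl, rfl, h4, hφ _ _ _ h5.symm h2, h3⟩)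
  simpa [Nat.card_eq_fintype_card] using this

/-- Every word is a factor of some product of words of `X`. -/
def Complete (X : Set (List A)) : Prop := ∀ w, ∃ u v, u ++ w ++ v ∈ star X

theorem complete_iff_bounded {X : Set (List A)} {m : ℕ} (h : HasIndex (star X) m) :
    Complete X ↔ ∀ w : List A, w.length < 2 ^ m →
      ∃ u : List A, u.length < m ∧ ∃ v : List A, v.length < m ∧ u ++ w ++ v ∈ star X := by
  constructor
  · intro hc w _
    obtain ⟨u₀, v₀, h₀⟩ := hc w
    obtain ⟨φ, hφ⟩ := id h
    -- The left context is shortened with the right one quantified away; the right one is then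
    -- shortened for that fixed left context.
    have h1 : HasIndex {u | ∃ v, u ++ w ++ v ∈ star X} m := by
      refine ⟨φ, ?_⟩
      rintro u u' v hu ⟨t, ht⟩
      refine ⟨t, ?_⟩
      simp only [List.append_assoc] at ht ⊢
      exact hφ _ _ _ hu ht
    obtain ⟨u, ⟨v₁, h2⟩, hu⟩ := h1.exists_short ⟨u₀, v₀, h₀⟩
    obtain ⟨v, h3, hv⟩ := (h.residual (u ++ w)).exists_short ⟨v₁, h2⟩
    exact ⟨u, hu, v, hv, h3⟩
  · intro hb
    by_contra hc
    obtain ⟨φ, hφ⟩ := id h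
    -- The class of `w` is the set of classes of all `u ++ w`. The complement has the same index, so
    -- some word that is not a factor is short.
    have h1 : HasIndex {w | ∃ u v, u ++ w ++ v ∈ star X} (2 ^ m) := by
      have := HasIndex.of_finite (L := {w | ∃ u v, u ++ w ++ v ∈ star X})
        (fun w => ({f | ∃ u, φ (u ++ w) = f} : Set (Fin m))) (by
          rintro w w' t hw ⟨u, v, huv⟩
          obtain ⟨u', hu'⟩ := (Set.ext_iff.1 hw (φ (u ++ w))).1 ⟨u, rfl⟩
          refine ⟨u', v, ?_⟩
          have := hφ _ _ (t ++ v) hu'.symm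
          simp only [List.append_assoc] at this huv ⊢
          exact this huv)
      simpa [Nat.card_eq_fintype_card] using this
    simp only [Complete, not_forall] at hc
    obtain ⟨w, hw, hlt⟩ := h1.compl.exists_short hc
    obtain ⟨u, -, v, -, h⟩ := hb w hlt
    exact hw ⟨u, v, h⟩

/-- Cancel equal leading factors from two distinct factorizations. At the first disagreement one
factor is a proper prefix `x` of the other, `x ++ s`. -/
theorem not_uniquelyDecodable_iff {Y : Set (List A)} (h0 : [] ∉ Y) :
    ¬ UniquelyDecodable Y ↔
      ∃ x s t : List A, x ∈ Y ∧ x ++ s ∈ Y ∧ s ≠ [] ∧ t ∈ star Y ∧ s ++ t ∈ star Y := by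
  constructor
  · intro h
    simp only [UniquelyDecodable, not_forall] at h
    obtain ⟨L, K, hL, hK, h, hne⟩ := h
    induction L generalizing K with
    | nil =>
      cases K with
      | nil => exact absurd rfl hne
      | cons y K =>
        simp only [List.flatten_nil, List.flatten_cons, List.nil_eq_append_iff] at h
        exact absurd (h.1 ▸ hK y (by simp)) h0
    | cons x L ih =>
      cases K with
      | nil =>
        simp only [List.flatten_nil, List.flatten_cons, List.append_eq_nil_iff] at h
        exact absurd (h.1 ▸ hL x (by simp)) h0
      | cons y K =>
        simp only [List.mem_cons, forall_eq_or_imp] at hL hK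
        simp only [List.flatten_cons] at h
        rcases List.append_eq_append_iff.1 h with ⟨s, rfl, h2⟩ | ⟨s, rfl, h2⟩
        · by_cases hs : s = []
          · subst hs
            simp only [List.append_nil, List.nil_append, ne_eq, List.cons.injEq, true_and] at *
            exact ih K hL.2 hK.2 h2 hne
          · exact ⟨x, s, K.flatten, hL.1, hK.1, hs, ⟨K, hK.2, rfl⟩, ⟨L, hL.2, h2⟩⟩
        · by_cases hs : s = []
          · subst hs
            simp only [List.append_nil, List.nil_append, ne_eq, List.cons.injEq, true_and] at *
            exact ih K hL.2 hK.2 h2.symm hne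
          · exact ⟨y, s, L.flatten, hK.1, hL.1, hs, ⟨L, hL.2, rfl⟩, ⟨K, hK.2, h2⟩⟩
  · rintro ⟨x, s, t, hx, hxs, hs, ⟨K, hK, rfl⟩, ⟨L, hL, h⟩⟩ hU
    have := hU (x :: L) ((x ++ s) :: K) (by simpa using ⟨hx, hL⟩) (by simpa using ⟨hxs, hK⟩)
      (by simp [h])
    simp only [List.cons.injEq, List.self_eq_append_right] at this
    exact hs this.1

/-- The words `x`, `s`, `t` are shortened in this order, the later ones quantified away each time.
The three bounds are the indices of the languages from which they are drawn. -/
theorem uniquelyDecodable_iff_bounded {Y : Set (List A)} {n m : ℕ} (hn : HasIndex Y n)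
    (hm : HasIndex (star Y) m) :
    UniquelyDecodable Y ↔ [] ∉ Y ∧ ¬ ∃ x : List A, x.length < n ∧ x ∈ Y ∧
      ∃ s : List A, s.length < n * 2 * m ∧ (x ++ s ∈ Y ∧ s ≠ []) ∧
        ∃ t : List A, t.length < m * m ∧ t ∈ star Y ∧ s ++ t ∈ star Y := by
  by_cases h0 : [] ∈ Y
  · exact iff_of_false (fun h => h.epsilon_not_mem h0) (fun h => h.1 h0)
  rw [← not_iff_not, not_uniquelyDecodable_iff h0]
  simp only [h0, not_false_eq_true, true_and, not_not]
  constructor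
  · rintro ⟨x₀, s₀, t₀, h1, h2, h3, h4, h5⟩
    have hx : HasIndex (Y ∩ {x | ∃ s t : List A, x ++ s ∈ Y ∧ s ≠ [] ∧ t ∈ star Y ∧
        s ++ t ∈ star Y}) n := by
      obtain ⟨φ, hφ⟩ := hn
      refine ⟨φ, ?_⟩
      rintro u u' v hu ⟨h, s, t, hs, h'⟩
      refine ⟨hφ _ _ _ hu h, s, t, ?_, h'⟩
      have := hφ _ _ (v ++ s) hu
      simp only [List.append_assoc] at this hs ⊢
      exact this hs
    obtain ⟨x, ⟨hxY, s₁, t₁, g2, g3, g4, g5⟩, hxl⟩ :=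
      hx.exists_short ⟨x₀, h1, s₀, t₀, h2, h3, h4, h5⟩
    have hs' : HasIndex {s | ∃ t ∈ star Y, s ++ t ∈ star Y} m := by
      obtain ⟨φ, hφ⟩ := hm
      refine ⟨φ, ?_⟩
      rintro u u' v hu ⟨t, ht, h⟩
      refine ⟨t, ht, ?_⟩
      have := hφ _ _ (v ++ t) hu
      simp only [List.append_assoc] at this h ⊢
      exact this h
    obtain ⟨s, ⟨⟨k1, k2⟩, t₂, k3, k4⟩, hsl⟩ :=
      (((hn.residual x).inter hasIndex_nonempty_words).inter hs').exists_short
        ⟨s₁, ⟨g2, g3⟩, t₁, g4, g5⟩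
    obtain ⟨t, ⟨l1, l2⟩, htl⟩ := (hm.inter (hm.residual s)).exists_short ⟨t₂, k3, k4⟩
    exact ⟨x, hxl, hxY, s, hsl, ⟨k1, k2⟩, t, htl, l1, l2⟩
  · rintro ⟨x, -, h1, s, -, ⟨h2, h3⟩, t, -, h4, h5⟩
    exact ⟨x, s, t, h1, h2, h3, h4, h5⟩

end Index

/-! ### Alignments of words and counting of edits. -/

section Alignments

variable {A : Type*}

/-- `Align x y d i s`: the word `x` can be aligned with `y` using `d` deletions, `i` insertions
and `s` substitutions. -/
inductive Align : List A → List A → ℕ → ℕ → ℕ → Prop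
  | nil : Align [] [] 0 0 0
  | keep (a : A) {x y : List A} {d i s : ℕ} : Align x y d i s → Align (a :: x) (a :: y) d i s
  | del (a : A) {x y : List A} {d i s : ℕ} : Align x y d i s → Align (a :: x) y (d + 1) i s
  | ins (b : A) {x y : List A} {d i s : ℕ} : Align x y d i s → Align x (b :: y) d (i + 1) s
  | sub {a b : A} {x y : List A} {d i s : ℕ} : a ≠ b → Align x y d i s →
      Align (a :: x) (b :: y) d i (s + 1)

namespace Align

theorem refl : ∀ x : List A, Align x x 0 0 0
  | [] => nil
  | a :: x => (refl x).keep a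

theorem symm {x y : List A} {d i s : ℕ} (h : Align x y d i s) : Align y x i d s := by
  induction h with
  | nil => exact nil
  | keep a _ ih => exact ih.keep a
  | del a _ ih => exact ih.ins a
  | ins a _ ih => exact ih.del a
  | sub hab _ ih => exact ih.sub hab.symm

theorem length_eq {x y : List A} {d i s : ℕ} (h : Align x y d i s) :
    x.length + i = y.length + d := by
  induction h <;> simp_all <;> omega

theorem append {x y x' y' : List A} {d i s d' i' s' : ℕ} (h : Align x y d i s)
    (h' : Align x' y' d' i' s') : Align (x ++ x') (y ++ y') (d + d') (i + i') (s + s') := by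
  induction h with
  | nil => simpa using h'
  | keep a _ ih => exact ih.keep a
  | del a _ ih => rw [Nat.add_right_comm]; exact ih.del a
  | ins a _ ih => rw [Nat.add_right_comm _ 1 i']; exact ih.ins a
  | sub hab _ ih => rw [Nat.add_right_comm _ 1 s']; exact ih.sub hab

theorem exists_of_append_left {u v y : List A} {d i s : ℕ} (h : Align (u ++ v) y d i s) :
    ∃ y₁ y₂ d₁ d₂ i₁ i₂ s₁ s₂, y = y₁ ++ y₂ ∧ d = d₁ + d₂ ∧ i = i₁ + i₂ ∧ s = s₁ + s₂ ∧
      Align u y₁ d₁ i₁ s₁ ∧ Align v y₂ d₂ i₂ s₂ := by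
  generalize hx : u ++ v = x at h
  induction h generalizing u with
  | nil =>
    obtain ⟨rfl, rfl⟩ := List.append_eq_nil_iff.1 hx
    exact ⟨[], [], 0, 0, 0, 0, 0, 0, rfl, rfl, rfl, rfl, nil, nil⟩
  | @keep a x y d i s h ih =>
    cases u with
    | nil => exact ⟨[], a :: y, 0, d, 0, i, 0, s, rfl, by simp, by simp, by simp, nil,
        by simp at hx; exact hx ▸ h.keep a⟩
    | cons b u =>
      obtain ⟨rfl, rfl⟩ := List.cons.inj hx
      obtain ⟨y₁, y₂, d₁, d₂, i₁, i₂, s₁, s₂, rfl, rfl, rfl, rfl, h1, h2⟩ := ih rfl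
      exact ⟨b :: y₁, y₂, _, _, _, _, _, _, rfl, rfl, rfl, rfl, h1.keep b, h2⟩
  | @del a x y d i s h ih =>
    cases u with
    | nil => exact ⟨[], y, 0, d + 1, 0, i, 0, s, rfl, by simp, by simp, by simp, nil,
        by simp at hx; exact hx ▸ h.del a⟩
    | cons b u =>
      obtain ⟨rfl, rfl⟩ := List.cons.inj hx
      obtain ⟨y₁, y₂, d₁, d₂, i₁, i₂, s₁, s₂, rfl, rfl, rfl, rfl, h1, h2⟩ := ih rfl
      exact ⟨y₁, y₂, d₁ + 1, d₂, _, _, _, _, rfl, by omega, rfl, rfl, h1.del b, h2⟩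
  | @ins a x y d i s h ih =>
    obtain ⟨y₁, y₂, d₁, d₂, i₁, i₂, s₁, s₂, rfl, rfl, rfl, rfl, h1, h2⟩ := ih hx
    exact ⟨a :: y₁, y₂, d₁, d₂, i₁ + 1, i₂, _, _, rfl, by omega, by omega, rfl, h1.ins a, h2⟩
  | @sub a b x y d i s hab h ih =>
    cases u with
    | nil => exact ⟨[], b :: y, 0, d, 0, i, 0, s + 1, rfl, by simp, by simp, by simp, nil,
        by simp at hx; exact hx ▸ h.sub hab⟩
    | cons c u =>
      obtain ⟨rfl, rfl⟩ := List.cons.inj hx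
      obtain ⟨y₁, y₂, d₁, d₂, i₁, i₂, s₁, s₂, rfl, rfl, rfl, rfl, h1, h2⟩ := ih rfl
      exact ⟨b :: y₁, y₂, d₁, d₂, _, _, s₁ + 1, s₂, rfl, by omega, rfl, by omega, h1.sub hab, h2⟩

theorem exists_of_append_right {x u v : List A} {d i s : ℕ} (h : Align x (u ++ v) d i s) :
    ∃ x₁ x₂ d₁ d₂ i₁ i₂ s₁ s₂, x = x₁ ++ x₂ ∧ d = d₁ + d₂ ∧ i = i₁ + i₂ ∧ s = s₁ + s₂ ∧
      Align x₁ u d₁ i₁ s₁ ∧ Align x₂ v d₂ i₂ s₂ := by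
  obtain ⟨x₁, x₂, i₁, i₂, d₁, d₂, s₁, s₂, h1, h2, h3, h4, h5, h6⟩ := h.symm.exists_of_append_left
  exact ⟨x₁, x₂, d₁, d₂, i₁, i₂, s₁, s₂, h1, h3, h2, h4, h5.symm, h6.symm⟩

theorem eq_of_zero {x y : List A} {d i s : ℕ} (h : Align x y d i s) (h0 : d + i + s = 0) :
    x = y := by
  induction h with
  | nil => rfl
  | keep a _ ih => rw [ih h0]
  | del | ins | sub => omega

/-- An alignment with few edits leaves one of many copies of a word untouched. -/
theorem exists_infix_of_lt {w y : List A} {m d i s : ℕ} {t : List A}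
    (h : Align ((List.replicate m w).flatten ++ t) y d i s) (hm : d + i + s < m) :
    ∃ u v, y = u ++ w ++ v := by
  induction m generalizing y d i s with
  | zero => omega
  | succ m ih =>
    simp only [List.replicate_succ, List.flatten_cons, List.append_assoc] at h
    obtain ⟨y₁, y₂, d₁, d₂, i₁, i₂, s₁, s₂, rfl, rfl, rfl, rfl, h1, h2⟩ := h.exists_of_append_left
    -- Either the first copy is unedited, or it absorbs at least one edit and fewer than `m` remain
    -- for the other `m` copies.
    by_cases h0 : d₁ + i₁ + s₁ = 0
    · exact ⟨[], y₂, by rw [h1.eq_of_zero h0]; simp⟩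
    · obtain ⟨u, v, rfl⟩ := ih h2 (by omega)
      exact ⟨y₁ ++ u, v, by simp⟩

/-- Alignments compose, and the number of edits is subadditive. -/
theorem comp {x y z : List A} {d i s d' i' s' : ℕ} (h : Align x y d i s)
    (h' : Align y z d' i' s') : ∃ d₁ i₁ s₁, Align x z d₁ i₁ s₁ ∧
      d₁ + i₁ + s₁ ≤ d + i + s + (d' + i' + s') ∧ (s = 0 → s' = 0 → s₁ = 0) := by
  -- The inner inductions peel off leading insertions of the second alignment, which consume no
  -- letter of the middle word. The last clause of the conclusion is what keeps substitutions out of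
  -- powers of δ₁ ∪ ι₁.
  induction h generalizing z d' i' s' with
  | nil => exact ⟨d', i', s', h', by omega, fun _ h => h⟩
  | del a _ ih =>
    obtain ⟨d₁, i₁, s₁, h1, h2, h3⟩ := ih h'
    exact ⟨d₁ + 1, i₁, s₁, h1.del a, by omega, h3⟩
  | @keep a x y d i s h ih =>
    generalize hy : a :: y = w at h'
    induction h' with
    | nil => cases hy
    | keep b h' =>
      obtain ⟨rfl, rfl⟩ := List.cons.inj hy
      obtain ⟨d₁, i₁, s₁, h1, h2, h3⟩ := ih h'
      exact ⟨d₁, i₁, s₁, h1.keep _, h2, h3⟩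
    | del b h' =>
      obtain ⟨rfl, rfl⟩ := List.cons.inj hy
      obtain ⟨d₁, i₁, s₁, h1, h2, h3⟩ := ih h'
      exact ⟨d₁ + 1, i₁, s₁, h1.del _, by omega, h3⟩
    | ins b h' ih' =>
      obtain ⟨d₁, i₁, s₁, h1, h2, h3⟩ := ih' hy
      exact ⟨d₁, i₁ + 1, s₁, h1.ins b, by omega, h3⟩
    | sub hbc h' =>
      obtain ⟨rfl, rfl⟩ := List.cons.inj hy
      obtain ⟨d₁, i₁, s₁, h1, h2, h3⟩ := ih h'
      exact ⟨d₁, i₁, s₁ + 1, h1.sub hbc, by omega, by omega⟩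
  | @ins a x y d i s h ih =>
    generalize hy : a :: y = w at h'
    induction h' with
    | nil => cases hy
    | keep b h' =>
      obtain ⟨rfl, rfl⟩ := List.cons.inj hy
      obtain ⟨d₁, i₁, s₁, h1, h2, h3⟩ := ih h'
      exact ⟨d₁, i₁ + 1, s₁, h1.ins _, by omega, h3⟩
    | del b h' =>
      obtain ⟨rfl, rfl⟩ := List.cons.inj hy
      obtain ⟨d₁, i₁, s₁, h1, h2, h3⟩ := ih h'
      exact ⟨d₁, i₁, s₁, h1, by omega, h3⟩
    | ins b h' ih' =>
      obtain ⟨d₁, i₁, s₁, h1, h2, h3⟩ := ih' hy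
      exact ⟨d₁, i₁ + 1, s₁, h1.ins b, by omega, h3⟩
    | sub hbc h' =>
      obtain ⟨rfl, rfl⟩ := List.cons.inj hy
      obtain ⟨d₁, i₁, s₁, h1, h2, h3⟩ := ih h'
      exact ⟨d₁, i₁ + 1, s₁, h1.ins _, by omega, by omega⟩
  | @sub a c x y d i s hac h ih =>
    generalize hy : c :: y = w at h'
    induction h' with
    | nil => cases hy
    | keep b h' =>
      obtain ⟨rfl, rfl⟩ := List.cons.inj hy
      obtain ⟨d₁, i₁, s₁, h1, h2, h3⟩ := ih h'
      exact ⟨d₁, i₁, s₁ + 1, h1.sub hac, by omega, by omega⟩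
    | del b h' =>
      obtain ⟨rfl, rfl⟩ := List.cons.inj hy
      obtain ⟨d₁, i₁, s₁, h1, h2, h3⟩ := ih h'
      exact ⟨d₁ + 1, i₁, s₁, h1.del _, by omega, by omega⟩
    | ins b h' ih' =>
      obtain ⟨d₁, i₁, s₁, h1, h2, h3⟩ := ih' hy
      exact ⟨d₁, i₁ + 1, s₁, h1.ins b, by omega, by omega⟩
    | @sub b e _ _ _ _ _ hbe h' =>
      obtain ⟨rfl, rfl⟩ := List.cons.inj hy
      obtain ⟨d₁, i₁, s₁, h1, h2, h3⟩ := ih h'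
      -- The second substitution may undo the first, which leaves an unedited letter.
      by_cases hae : a = e
      · subst hae
        exact ⟨d₁, i₁, s₁, h1.keep _, by omega, by omega⟩
      · exact ⟨d₁, i₁, s₁ + 1, h1.sub hae, by omega, by omega⟩

theorem sublist {x y : List A} {d i s : ℕ} (h : Align x y d i s) (h0 : i + s = 0) :
    y.Sublist x := by
  induction h with
  | nil => exact List.Sublist.slnil
  | keep a _ ih => exact (ih h0).cons_cons a
  | del a _ ih => exact (ih h0).cons a
  | ins | sub => omega

theorem sublist_iff {x y : List A} {k : ℕ} :
    Align x y k 0 0 ↔ y.Sublist x ∧ y.length + k = x.length := by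
  constructor
  · intro h
    exact ⟨h.sublist rfl, by simpa using h.length_eq.symm⟩
  · rintro ⟨h, hk⟩
    induction h generalizing k with
    | slnil => obtain rfl : k = 0 := by simpa using hk
               exact nil
    | @cons y x a h ih =>
      have := h.length_le
      obtain ⟨j, rfl⟩ : ∃ j, k = j + 1 := ⟨k - 1, by simp at hk; omega⟩
      exact (ih (by simp at hk; omega)).del a
    | cons_cons a _ ih => exact (ih (by simp at hk; omega)).keep a

/-- The differing positions of the tails are shifted by one; the last set contributes 0 or 1 for the
head. -/
theorem ncard_ne_cons {a b : A} {x y : List A} (h : x.length = y.length) :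
    {j : ℕ | (a :: x)[j]? ≠ (b :: y)[j]?}.ncard =
      {j : ℕ | x[j]? ≠ y[j]?}.ncard + {j : ℕ | j = 0 ∧ a ≠ b}.ncard := by
  have hf : {j : ℕ | x[j]? ≠ y[j]?}.Finite := by
    refine (Set.finite_lt_nat x.length).subset fun j hj => ?_
    by_contra hlt
    simp only [Set.mem_ofPred_eq, not_lt] at hlt hj
    rw [List.getElem?_eq_none hlt, List.getElem?_eq_none (h ▸ hlt)] at hj
    exact hj rfl
  have e : {j : ℕ | (a :: x)[j]? ≠ (b :: y)[j]?} =
      Nat.succ '' {j : ℕ | x[j]? ≠ y[j]?} ∪ {j : ℕ | j = 0 ∧ a ≠ b} := by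
    ext j
    cases j <;> simp
  rw [e, Set.ncard_union_eq ?_ (hf.image _) ((Set.finite_singleton 0).subset fun j hj => hj.1),
    Set.ncard_image_of_injective _ Nat.succ_injective]
  rw [Set.disjoint_left]
  rintro _ ⟨j, -, rfl⟩ ⟨h, -⟩
  omega

theorem ncard_ne {x y : List A} {d i s : ℕ} (h : Align x y d i s) (h0 : d + i = 0) :
    {j : ℕ | x[j]? ≠ y[j]?}.ncard = s := by
  induction h with
  | nil => simp
  | @keep a x y d i s h ih =>
    have := h.length_eq
    rw [ncard_ne_cons (by omega), ih h0]
    simp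
  | @sub a b x y d i s hab h ih =>
    have := h.length_eq
    rw [ncard_ne_cons (by omega), ih h0]
    simp [hab]
  | del | ins => omega

theorem sub_iff {x y : List A} {k : ℕ} :
    Align x y 0 0 k ↔ x.length = y.length ∧ {j : ℕ | x[j]? ≠ y[j]?}.ncard = k := by
  constructor
  · intro h
    exact ⟨by simpa using h.length_eq, h.ncard_ne rfl⟩
  · rintro ⟨h, rfl⟩
    induction x generalizing y with
    | nil =>
      obtain rfl : y = [] := by simpa using h.symm
      simpa using nil
    | cons a x ih =>
      cases y with
      | nil => simp at h
      | cons b y =>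
        have hl : x.length = y.length := by simpa using h
        rw [ncard_ne_cons hl]
        by_cases hab : a = b
        · subst hab
          simpa using (ih hl).keep a
        · simpa [hab] using (ih hl).sub hab

end Align

end Alignments

/-! ### The edit relations as alignment relations, and regularity of their images. -/

section EditRelations

variable {A : Type*}

/-- The pairs of distinct words that can be aligned with numbers of deletions, insertions and
substitutions admitted by `C k`. -/
def editRel (C : ℕ → ℕ → ℕ → ℕ → Prop) (k : ℕ) : WordRel A :=
  {p | p.1 ≠ p.2 ∧ ∃ d i s, C k d i s ∧ Align p.1 p.2 d i s}

theorem mem_editRel {C : ℕ → ℕ → ℕ → ℕ → Prop} {k : ℕ} {x y : List A} :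
    (x, y) ∈ editRel C k ↔ x ≠ y ∧ ∃ d i s, C k d i s ∧ Align x y d i s := Iff.rfl

namespace WordRel

theorem mem_antirefl {τ : WordRel A} {x y : List A} :
    (x, y) ∈ antirefl τ ↔ (x, y) ∈ τ ∧ x ≠ y := Iff.rfl

theorem antirefl_editRel (C : ℕ → ℕ → ℕ → ℕ → Prop) (k : ℕ) :
    antirefl (editRel C k : WordRel A) = editRel C k := by
  ext ⟨x, y⟩
  rw [mem_antirefl]
  exact ⟨fun h => h.1, fun h => ⟨h, h.1⟩⟩

theorem mem_del {k : ℕ} {x y : List A} : (x, y) ∈ del k ↔ Align x y k 0 0 :=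
  Align.sublist_iff.symm

theorem mem_ins {k : ℕ} {x y : List A} : (x, y) ∈ ins k ↔ Align x y 0 k 0 := by
  have : (x, y) ∈ ins k ↔ (y, x) ∈ del k := Iff.rfl
  rw [this, mem_del]
  exact ⟨Align.symm, Align.symm⟩

theorem mem_sub {k : ℕ} {x y : List A} : (x, y) ∈ sub k ↔ Align x y 0 0 k :=
  Align.sub_iff.symm

theorem mem_delUpTo {k : ℕ} {x y : List A} :
    (x, y) ∈ delUpTo k ↔ ∃ j, (1 ≤ j ∧ j ≤ k) ∧ Align x y j 0 0 := by
  simp only [delUpTo, Set.mem_iUnion, Set.mem_Icc, mem_del, exists_prop]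

theorem mem_insUpTo {k : ℕ} {x y : List A} :
    (x, y) ∈ insUpTo k ↔ ∃ j, (1 ≤ j ∧ j ≤ k) ∧ Align x y 0 j 0 := by
  simp only [insUpTo, Set.mem_iUnion, Set.mem_Icc, mem_ins, exists_prop]

theorem mem_pow_succ {τ : WordRel A} {n : ℕ} {x z : List A} :
    (x, z) ∈ pow τ (n + 1) ↔ ∃ y, (x, y) ∈ pow τ n ∧ (y, z) ∈ τ := Iff.rfl

theorem mem_pow_succ_of_mem {τ : WordRel A} {n : ℕ} {x y z : List A} (h : (x, y) ∈ τ)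
    (h' : (y, z) ∈ pow τ n) : (x, z) ∈ pow τ (n + 1) := by
  induction n generalizing z with
  | zero =>
    obtain rfl : y = z := h'
    exact ⟨x, rfl, h⟩
  | succ n ih =>
    obtain ⟨w, hw, hwz⟩ := mem_pow_succ.1 h'
    exact ⟨w, ih hw, hwz⟩

theorem cons_mem_pow {τ : WordRel A} (hτ : ∀ a x y, (x, y) ∈ τ → (a :: x, a :: y) ∈ τ) {n : ℕ}
    (a : A) {x y : List A} (h : (x, y) ∈ pow τ n) : (a :: x, a :: y) ∈ pow τ n := by
  induction n generalizing y with
  | zero =>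
    obtain rfl : x = y := h
    rfl
  | succ n ih =>
    obtain ⟨w, hw, hwy⟩ := mem_pow_succ.1 h
    exact ⟨a :: w, ih hw, hτ _ _ _ hwy⟩

/-- Edits are performed from left to right: each one at the head of the current word, the remaining
ones behind the letter it leaves. The latter uses stability of `τ` under a common first letter. -/
theorem mem_pow_of_align {τ : WordRel A} (hτ : ∀ a x y, (x, y) ∈ τ → (a :: x, a :: y) ∈ τ)
    (hd : del 1 ⊆ τ) (hi : ins 1 ⊆ τ) {x y : List A} {d i s : ℕ} (h : Align x y d i s)
    (hs : s ≠ 0 → sub 1 ⊆ τ) : (x, y) ∈ pow τ (d + i + s) := by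
  induction h with
  | nil => rfl
  | keep a _ ih => exact cons_mem_pow hτ a (ih hs)
  | @del a x y d i s _ ih =>
    rw [show d + 1 + i + s = d + i + s + 1 by omega]
    exact mem_pow_succ_of_mem (hd (mem_del.2 ((Align.refl x).del a))) (ih hs)
  | @ins a x y d i s _ ih =>
    rw [show d + (i + 1) + s = d + i + s + 1 by omega]
    exact mem_pow_succ_of_mem (hi (mem_ins.2 ((Align.refl x).ins a)))
      (cons_mem_pow hτ a (ih hs))
  | @sub a b x y d i s hab _ ih =>
    exact mem_pow_succ_of_mem (hs (by omega) (mem_sub.2 ((Align.refl x).sub hab)))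
      (cons_mem_pow hτ b (ih fun _ => hs (by omega)))

/-- The proposition `P` serves both relations: `True` forbids substitutions, as for S_k, and `False`
permits them, as for Λ_k. -/
theorem exists_align_of_mem_pow {τ : WordRel A} {P : Prop}
    (hτ : ∀ x y, (x, y) ∈ τ → ∃ d i s, Align x y d i s ∧ d + i + s ≤ 1 ∧ (P → s = 0)) {n : ℕ}
    {x y : List A} (h : (x, y) ∈ pow τ n) :
    ∃ d i s, Align x y d i s ∧ d + i + s ≤ n ∧ (P → s = 0) := by
  induction n generalizing y with
  | zero =>
    obtain rfl : x = y := h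
    exact ⟨0, 0, 0, Align.refl x, le_rfl, fun _ => rfl⟩
  | succ n ih =>
    obtain ⟨w, hw, hwy⟩ := mem_pow_succ.1 h
    obtain ⟨d, i, s, h1, h2, h3⟩ := ih hw
    obtain ⟨d', i', s', h1', h2', h3'⟩ := hτ _ _ hwy
    obtain ⟨d₁, i₁, s₁, h4, h5, h6⟩ := h1.comp h1'
    exact ⟨d₁, i₁, s₁, h4, by omega, fun hP => h6 (h3 hP) (h3' hP)⟩

/-- For `k = 0` the relation would be the identity; for `k ≥ 1` the change of length makes the two
words distinct. -/
theorem del_eq_editRel {k : ℕ} (hk : 1 ≤ k) :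
    (del k : WordRel A) = editRel (fun k d i s => d = k ∧ i = 0 ∧ s = 0) k := by
  ext ⟨x, y⟩
  rw [mem_del, mem_editRel]
  constructor
  · intro h
    refine ⟨?_, k, 0, 0, ⟨rfl, rfl, rfl⟩, h⟩
    rintro rfl
    have := h.length_eq
    omega
  · rintro ⟨-, _, _, _, ⟨rfl, rfl, rfl⟩, h⟩
    exact h

theorem ins_eq_editRel {k : ℕ} (hk : 1 ≤ k) :
    (ins k : WordRel A) = editRel (fun k d i s => d = 0 ∧ i = k ∧ s = 0) k := by
  ext ⟨x, y⟩
  rw [mem_ins, mem_editRel]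
  constructor
  · intro h
    refine ⟨?_, 0, k, 0, ⟨rfl, rfl, rfl⟩, h⟩
    rintro rfl
    have := h.length_eq
    omega
  · rintro ⟨-, _, _, _, ⟨rfl, rfl, rfl⟩, h⟩
    exact h

theorem sub_eq_editRel {k : ℕ} (hk : 1 ≤ k) :
    (sub k : WordRel A) = editRel (fun k d i s => d = 0 ∧ i = 0 ∧ s = k) k := by
  ext ⟨x, y⟩
  rw [mem_sub, mem_editRel]
  constructor
  · intro h
    refine ⟨?_, 0, 0, k, ⟨rfl, rfl, rfl⟩, h⟩
    rintro rfl
    have := h.ncard_ne rfl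
    simp at this
    omega
  · rintro ⟨-, _, _, _, ⟨rfl, rfl, rfl⟩, h⟩
    exact h

theorem delUpTo_eq_editRel (k : ℕ) :
    (delUpTo k : WordRel A) = editRel (fun k d i s => (1 ≤ d ∧ d ≤ k) ∧ i = 0 ∧ s = 0) k := by
  ext ⟨x, y⟩
  rw [mem_delUpTo, mem_editRel]
  constructor
  · rintro ⟨j, hj, h⟩
    refine ⟨?_, j, 0, 0, ⟨hj, rfl, rfl⟩, h⟩
    rintro rfl
    have := h.length_eq
    omega
  · rintro ⟨-, d, _, _, ⟨hd, rfl, rfl⟩, h⟩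
    exact ⟨d, hd, h⟩

theorem insUpTo_eq_editRel (k : ℕ) :
    (insUpTo k : WordRel A) = editRel (fun k d i s => d = 0 ∧ (1 ≤ i ∧ i ≤ k) ∧ s = 0) k := by
  ext ⟨x, y⟩
  rw [mem_insUpTo, mem_editRel]
  constructor
  · rintro ⟨j, hj, h⟩
    refine ⟨?_, 0, j, 0, ⟨rfl, hj, rfl⟩, h⟩
    rintro rfl
    have := h.length_eq
    omega
  · rintro ⟨-, _, i, _, ⟨rfl, hi, rfl⟩, h⟩
    exact ⟨i, hi, h⟩

theorem antirefl_indel_eq_editRel (k : ℕ) :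
    antirefl (indel k : WordRel A) = editRel (fun k d i s => d + i ≤ k ∧ s = 0) k := by
  ext ⟨x, y⟩
  rw [mem_antirefl, mem_editRel]
  simp only [indel, Set.mem_iUnion, Set.mem_Icc, exists_prop]
  constructor
  · rintro ⟨⟨j, hj, h⟩, hne⟩
    obtain ⟨d, i, s, h1, h2, h3⟩ := exists_align_of_mem_pow (P := True) (by
      rintro x y (h | h)
      · exact ⟨1, 0, 0, mem_del.1 h, le_rfl, fun _ => rfl⟩
      · exact ⟨0, 1, 0, mem_ins.1 h, le_rfl, fun _ => rfl⟩) h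
    exact ⟨hne, d, i, s, ⟨by omega, h3 trivial⟩, h1⟩
  · rintro ⟨hne, d, i, s, ⟨hdi, rfl⟩, h⟩
    refine ⟨⟨d + i, ⟨?_, hdi⟩, ?_⟩, hne⟩
    -- An alignment without edits would make the words equal, so the exponent is at least 1.
    · by_contra h0
      exact hne (h.eq_of_zero (by omega))
    · refine mem_pow_of_align ?_ Set.subset_union_left Set.subset_union_right h (by simp)
      rintro a x y (h | h)
      · exact Or.inl (mem_del.2 ((mem_del.1 h).keep a))
      · exact Or.inr (mem_ins.2 ((mem_ins.1 h).keep a))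

theorem antirefl_lev_eq_editRel (k : ℕ) :
    antirefl (lev k : WordRel A) = editRel (fun k d i s => d + i + s ≤ k) k := by
  ext ⟨x, y⟩
  rw [mem_antirefl, mem_editRel]
  simp only [lev, Set.mem_iUnion, Set.mem_Icc, exists_prop]
  constructor
  · rintro ⟨⟨j, hj, h⟩, hne⟩
    obtain ⟨d, i, s, h1, h2, -⟩ := exists_align_of_mem_pow (P := False) (by
      rintro x y ((h | h) | h)
      · exact ⟨1, 0, 0, mem_del.1 h, le_rfl, False.elim⟩
      · exact ⟨0, 1, 0, mem_ins.1 h, le_rfl, False.elim⟩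
      · exact ⟨0, 0, 1, mem_sub.1 h, le_rfl, False.elim⟩) h
    exact ⟨hne, d, i, s, by omega, h1⟩
  · rintro ⟨hne, d, i, s, hdi, h⟩
    refine ⟨⟨d + i + s, ⟨?_, hdi⟩, ?_⟩, hne⟩
    · by_contra h0
      exact hne (h.eq_of_zero (by omega))
    · refine mem_pow_of_align ?_ (Set.subset_union_left.trans Set.subset_union_left)
        (Set.subset_union_right.trans Set.subset_union_left) h (fun _ => Set.subset_union_right)
      rintro a x y ((h | h) | h)
      · exact Or.inl (Or.inl (mem_del.2 ((mem_del.1 h).keep a)))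
      · exact Or.inl (Or.inr (mem_ins.2 ((mem_ins.1 h).keep a)))
      · exact Or.inr (mem_sub.2 ((mem_sub.1 h).keep a))

end WordRel

/-- The letters by which one of two prefix-comparable words exceeds the other, or `none` if the
words are not comparable. -/
noncomputable def offset (K : ℕ) (x u : List A) :
    Option ((Fin K → Option A) × (Fin K → Option A)) := by
  classical
  exact if x <+: u ∨ u <+: x then
    some (fun j => (x.drop u.length)[(j : ℕ)]?, fun j => (u.drop x.length)[(j : ℕ)]?) else none

theorem append_eq_append_iff_drop {x u p q : List A} (h : x <+: u ∨ u <+: x) :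
    x ++ p = u ++ q ↔ x.drop u.length ++ p = u.drop x.length ++ q := by
  rcases h with ⟨e, rfl⟩ | ⟨e, rfl⟩ <;> simp [List.drop_eq_nil_of_le]

theorem eq_of_getElem?_fin {K : ℕ} {x y : List A} (hx : x.length ≤ K) (hy : y.length ≤ K)
    (h : ∀ j : Fin K, x[(j : ℕ)]? = y[(j : ℕ)]?) : x = y := by
  refine List.ext_getElem? fun j => ?_
  by_cases hj : j < K
  · exact h ⟨j, hj⟩
  · rw [List.getElem?_eq_none (by omega), List.getElem?_eq_none (by omega)]

/-- Equality of the extended words depends only on the overhang of one prefix beyond the other. The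
overhang has at most `K` letters, so `offset` retains all of it. -/
theorem append_eq_append_of_offset_eq {K : ℕ} {x u x' u' p q : List A}
    (hx : x.length ≤ u.length + K) (hu : u.length ≤ x.length + K)
    (hx' : x'.length ≤ u'.length + K) (hu' : u'.length ≤ x'.length + K)
    (h : offset K x u = offset K x' u') (he : x ++ p = u ++ q) : x' ++ p = u' ++ q := by
  have hc : x <+: u ∨ u <+: x := by
    have h1 : x <+: x ++ p := ⟨p, rfl⟩
    have h2 : u <+: x ++ p := ⟨q, he.symm⟩
    exact List.prefix_or_prefix_of_prefix h1 h2
  rw [offset, if_pos hc, offset] at h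
  split_ifs at h with hc'
  simp only [Option.some.injEq, Prod.mk.injEq, funext_iff] at h
  rw [append_eq_append_iff_drop hc] at he
  rw [append_eq_append_iff_drop hc']
  rwa [← eq_of_getElem?_fin (by simp; omega) (by simp; omega) h.1,
    ← eq_of_getElem?_fin (by simp; omega) (by simp; omega) h.2]

/-- The class of `u` is the set of data (class of `x`, three edit counts, offset) over all `x`
aligned with `u`. An alignment ending in `u ++ v` splits at the cut, and its first half can be
exchanged for one with the same data. The offset is recorded because the relation demands distinct
words, a condition on both halves together. -/
theorem HasIndex.image_editRel [Finite A] {X : Set (List A)} {n : ℕ} (hX : HasIndex X n)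
    {C : ℕ → ℕ → ℕ → ℕ → Prop} {k K : ℕ}
    (hC : ∀ d i s, C k d i s → d ≤ K ∧ i ≤ K ∧ s ≤ K) :
    HasIndex ((editRel C k).image X) (2 ^ (n * ((K + 1) * ((K + 1) * ((K + 1) *
      ((Nat.card A + 1) ^ K * (Nat.card A + 1) ^ K + 1)))))) := by
  obtain ⟨φ, hφ⟩ := hX
  have := HasIndex.of_finite (L := (editRel C k).image X)
    (fun u => ({f | ∃ x, φ x = f.1 ∧ Align x u f.2.1 f.2.2.1 f.2.2.2.1 ∧
      offset K x u = f.2.2.2.2} : Set (Fin n × Fin (K + 1) × Fin (K + 1) × Fin (K + 1) ×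
        Option ((Fin K → Option A) × (Fin K → Option A))))) (by
    rintro u u' v h ⟨x, hx, hne, d, i, s, hc, hal⟩
    obtain ⟨x₁, x₂, d₁, d₂, i₁, i₂, s₁, s₂, rfl, rfl, rfl, rfl, h1, h2⟩ :=
      hal.exists_of_append_right
    obtain ⟨b1, b2, b3⟩ := hC _ _ _ hc
    obtain ⟨x', e1, e2, e3⟩ := (Set.ext_iff.1 h (φ x₁, ⟨d₁, by omega⟩, ⟨i₁, by omega⟩,
      ⟨s₁, by omega⟩, offset K x₁ u)).1 ⟨x₁, rfl, h1, rfl⟩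
    simp only at e1 e2 e3
    refine ⟨x' ++ x₂, hφ _ _ _ e1.symm hx, ?_, _, _, _, hc, e2.append h2⟩
    have l1 := h1.length_eq
    have l2 := e2.length_eq
    exact fun he => hne (append_eq_append_of_offset_eq (by omega) (by omega) (by omega)
      (by omega) e3 he))
  convert this using 1
  have := Fintype.ofFinite A
  classical
  simp [Nat.card_eq_fintype_card]

end EditRelations

/-! ### Enlarging an incomplete independent code. -/

section Extension

variable {A : Type*}

theorem forall_mem_or_exists_eq_append_cons {X : Set (List A)} {z : List A} (L : List (List A))
    (hL : ∀ x ∈ L, x ∈ insert z X) : (∀ x ∈ L, x ∈ X) ∨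
      ∃ P R, L = P ++ z :: R ∧ (∀ x ∈ P, x ∈ X) ∧ ∀ x ∈ R, x ∈ insert z X := by
  induction L with
  | nil => exact Or.inl (by simp)
  | cons y L ih =>
    rw [List.forall_mem_cons] at hL
    rcases hL.1 with rfl | hy
    · exact Or.inr ⟨[], L, rfl, by simp, hL.2⟩
    · rcases ih hL.2 with h | ⟨P, R, rfl, hP, hR⟩
      · exact Or.inl (List.forall_mem_cons.2 ⟨hy, h⟩)
      · exact Or.inr ⟨y :: P, R, rfl, List.forall_mem_cons.2 ⟨hy, hP⟩, hR⟩

/-- Otherwise the left `z` starts inside `q`. It then lies within `q`, which makes it a factor of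
X*, or it overlaps the right `z` in a nonempty border. -/
theorem length_le_of_unbordered {X : Set (List A)} {z : List A}
    (hz : ∀ u v, u ++ z ++ v ∉ star X)
    (hb : ∀ e g h : List A, z = e ++ g → z = g ++ h → e ≠ [] → g = [])
    {p q r t : List A} (hq : q ∈ star X) (h : p ++ (z ++ r) = q ++ (z ++ t)) :
    q.length ≤ p.length := by
  by_contra hlt
  rcases List.append_eq_append_iff.1 h with ⟨e, rfl, h1⟩ | ⟨e, rfl, -⟩
  · rcases List.append_eq_append_iff.1 h1 with ⟨f, rfl, -⟩ | ⟨g, hg, h2⟩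
    · exact hz p f (by simpa using hq)
    · have he : e ≠ [] := by rintro rfl; simp at hlt
      rcases List.append_eq_append_iff.1 h2 with ⟨f, rfl, -⟩ | ⟨f, rfl, -⟩
      · have := congrArg List.length hg
        have := List.length_pos_iff.2 he
        simp at *
        omega
      · have h3 := hb e _ f hg rfl he
        subst h3
        simp only [List.nil_append] at *
        exact hz p [] (by simpa [hg] using hq)
  · simp at hlt

/-- Adding an unbordered word that is a factor of no product of words of a code yields a code. -/
theorem uniquelyDecodable_insert {X : Set (List A)} (hX : UniquelyDecodable X) {z : List A}
    (hz : ∀ u v, u ++ z ++ v ∉ star X)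
    (hb : ∀ e g h : List A, z = e ++ g → z = g ++ h → e ≠ [] → g = []) :
    UniquelyDecodable (insert z X) := by
  intro L K hL hK h
  induction hl : L.length using Nat.strong_induction_on generalizing L K with
  | _ l ih =>
    rcases forall_mem_or_exists_eq_append_cons L hL with h1 | ⟨P, R, rfl, hP, hR⟩ <;>
    rcases forall_mem_or_exists_eq_append_cons K hK with h2 | ⟨Q, T, rfl, hQ, hT⟩
    · exact hX L K h1 h2 h
    · exact absurd ⟨L, h1, by simpa using h⟩ (hz Q.flatten T.flatten)
    · exact absurd ⟨K, h2, by simpa using h.symm⟩ (hz P.flatten R.flatten)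
    · simp only [List.flatten_append, List.flatten_cons] at h
      -- By symmetry the first occurrences of `z` in the two factorizations start at the same place,
      -- so both sides split there.
      have hlen : P.flatten.length = Q.flatten.length :=
        le_antisymm (length_le_of_unbordered hz hb ⟨P, hP, rfl⟩ h.symm)
          (length_le_of_unbordered hz hb ⟨Q, hQ, rfl⟩ h)
      obtain ⟨h3, h4⟩ := List.append_inj h hlen
      rw [hX P Q hP hQ h3, ih R.length (by simp at hl; omega) R T hR hT
        (List.append_cancel_left h4) rfl]

/-- A nonempty border starts with `a`, so as a suffix it reaches back beyond the tail of `b`s, which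
is as long as `a :: v`. As a prefix it then contains all of `a :: v`, hence every `a` of the word;
but as a suffix it misses the first one. -/
theorem unbordered_append_replicate {a b : A} (hab : a ≠ b) (v : List A) (e g h : List A)
    (h1 : a :: v ++ List.replicate (v.length + 1) b = e ++ g)
    (h2 : a :: v ++ List.replicate (v.length + 1) b = g ++ h) (he : e ≠ []) : g = [] := by
  classical
  by_contra hg
  obtain ⟨c, e, rfl⟩ := List.exists_cons_of_ne_nil he
  obtain ⟨c', g', rfl⟩ := List.exists_cons_of_ne_nil hg
  obtain rfl : a = c := (List.cons.inj h1).1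
  obtain rfl : a = c' := (List.cons.inj h2).1
  rcases List.append_eq_append_iff.1 h1 with ⟨f, -, h3⟩ | ⟨f, -, h3⟩
  · have : a ∈ List.replicate (v.length + 1) b := by rw [h3]; simp
    exact hab (List.eq_of_mem_replicate this)
  · rcases List.append_eq_append_iff.1 h2 with ⟨f', h4, -⟩ | ⟨f', h4, h5⟩
    · have c1 := congrArg (List.count a) h1
      have c2 := congrArg (List.count a) h4
      simp [List.count_append, List.count_replicate, hab.symm] at c1 c2
      omega
    · have l1 := congrArg List.length h3
      have l2 := congrArg List.length h4
      simp at l1 l2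
      obtain rfl : f = [] := by
        rw [← List.length_eq_zero_iff]; omega
      have : a ∈ List.replicate (v.length + 1) b := by
        rw [List.nil_append] at h3; rw [← h3]; simp
      exact hab (List.eq_of_mem_replicate this)

/-- The new word starts with `3 * K + 1` copies of a word `w` that is not a factor of X*. An
alignment admitted by `C k` uses at most `3 * K` edits, so every word related to the new one, in
either direction, still contains `w` and lies outside `X`. The tail of `b`s makes the new word
unbordered. -/
theorem exists_insert_of_not_complete [Nontrivial A] {X : Set (List A)}
    (hX : UniquelyDecodable X) (hc : ¬ Complete X) {C : ℕ → ℕ → ℕ → ℕ → Prop} {k K : ℕ}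
    (hC : ∀ d i s, C k d i s → d ≤ K ∧ i ≤ K ∧ s ≤ K) (hi : (editRel C k).Independent X) :
    ∃ z ∉ X, UniquelyDecodable (insert z X) ∧ (editRel C k).Independent (insert z X) := by
  simp only [Complete, not_forall, not_exists] at hc
  obtain ⟨w, hw⟩ := hc
  cases w with
  | nil => exact absurd (nil_mem_star X) (hw [] [])
  | cons a w =>
    obtain ⟨b, hba⟩ := exists_ne a
    obtain ⟨v, hv⟩ : ∃ v, (List.replicate (3 * K + 1) (a :: w)).flatten = a :: v :=
      ⟨w ++ (List.replicate (3 * K) (a :: w)).flatten, by simp [List.replicate_succ]⟩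
    have key : ∀ y d i s, C k d i s ∨ C k i d s →
        Align (a :: v ++ List.replicate (v.length + 1) b) y d i s → y ∉ X := by
      intro y d i s hc h hy
      rw [← hv] at h
      have hlt : d + i + s < 3 * K + 1 := by
        rcases hc with hc | hc <;> have := hC _ _ _ hc <;> omega
      obtain ⟨p, q, rfl⟩ := h.exists_infix_of_lt hlt
      exact hw p q (subset_star X hy)
    have hz : ∀ p q, p ++ (a :: v ++ List.replicate (v.length + 1) b) ++ q ∉ star X := by
      intro p q h
      rw [← hv, List.replicate_succ, List.flatten_cons] at h
      exact hw p ((List.replicate (3 * K) (a :: w)).flatten ++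
        (List.replicate (v.length + 1) b ++ q)) (by simpa using h)
    refine ⟨a :: v ++ List.replicate (v.length + 1) b, ?_,
      uniquelyDecodable_insert hX hz (unbordered_append_replicate hba.symm v), ?_⟩
    · exact fun h => hz [] [] (by simpa using subset_star X h)
    · rw [WordRel.Independent, Set.eq_empty_iff_forall_notMem] at hi ⊢
      rintro y ⟨⟨x, hx, hxy⟩, hy⟩
      obtain ⟨hne, d, i, s, hc, hal⟩ := mem_editRel.1 hxy
      rcases hx with rfl | hx <;> rcases hy with rfl | hy
      · exact hne rfl
      · exact key y d i s (Or.inl hc) hal hy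
      · exact key x i d s (Or.inr hc) hal.symm hx
      · exact hi y ⟨⟨x, hx, hxy⟩, hy⟩

end Extension

/-! ### Regular codes are thin. -/

section Thin

variable {A : Type*}

theorem residual_append (L : Set (List A)) (u v : List A) :
    residual L (u ++ v) = residual (residual L u) v := by
  ext w
  simp [residual]

theorem HasIndex.finite_range_residual {L : Set (List A)} {n : ℕ} (hL : HasIndex L n) :
    (Set.range (EditCodes.residual L)).Finite := by
  obtain ⟨φ, hφ⟩ := hL
  have : ∀ u u', φ u = φ u' → EditCodes.residual L u = EditCodes.residual L u' :=
    fun u u' h => Set.ext fun v => ⟨hφ u u' v h, hφ u' u v h.symm⟩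
  have hF := Set.finite_range
    (fun f : Set.range φ => EditCodes.residual L (Classical.choose f.2))
  refine hF.subset ?_
  rintro _ ⟨u, rfl⟩
  exact ⟨⟨φ u, u, rfl⟩, this _ _ (Classical.choose_spec (⟨u, rfl⟩ : φ u ∈ Set.range φ))⟩

theorem flatten_replicate_append_comm (t y : List A) (m : ℕ) :
    (List.replicate m (t ++ y)).flatten ++ t = t ++ (List.replicate m (y ++ t)).flatten := by
  induction m with
  | zero => simp
  | succ m ih => simp only [List.replicate_succ, List.flatten_cons, List.append_assoc, ih]

theorem residual_iterate (L : Set (List A)) (u r : List A) (m : ℕ) :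
    (fun q => residual q r)^[m] (residual L u) =
      residual L (u ++ (List.replicate m r).flatten) := by
  induction m with
  | zero => simp
  | succ m ih =>
    rw [Function.iterate_succ_apply', ih, ← residual_append]
    congr 1
    rw [List.replicate_succ', List.flatten_append]
    simp

/-- Some word is a factor of no word of a given regular code. -/
theorem exists_not_infix_of_uniquelyDecodable {X : Set (List A)} {n : ℕ} (hn : HasIndex X n)
    (hX : UniquelyDecodable X) : ∃ w, ∀ u v, u ++ w ++ v ∉ X := by
  by_contra hall
  push Not at hall
  -- Left quotients serve as the states of the minimal automaton. `Im w` is the set of live states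
  -- reached by reading `w`, and `w` is then chosen to make it as small as possible.
  let Im : List A → Set (Set (List A)) := fun w => {q | ∃ u, q = residual X (u ++ w) ∧ q.Nonempty}
  have hfin : ∀ w, (Im w).Finite := fun w =>
    hn.finite_range_residual.subset (by rintro _ ⟨u, rfl, -⟩; exact ⟨_, rfl⟩)
  obtain ⟨w, hw⟩ : ∃ w, ∀ w', (Im w).ncard ≤ (Im w').ncard :=
    ⟨Function.argmin fun w => (Im w).ncard, fun w' => Function.argmin_le (fun w => (Im w).ncard) w'⟩
  obtain ⟨v, t, hvt⟩ := hall w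
  obtain ⟨r, hr⟩ : ∃ r, r = t ++ (v ++ w) := ⟨_, rfl⟩
  obtain ⟨f, hf⟩ : ∃ f : Set (List A) → Set (List A), f = fun q => residual q r := ⟨_, rfl⟩
  have h1 : Im (w ++ r) ⊆ f '' Im w := by
    rintro _ ⟨u, rfl, h⟩
    rw [← List.append_assoc, residual_append] at h ⊢
    obtain ⟨s, hs⟩ := h
    exact ⟨_, ⟨u, rfl, ⟨r ++ s, hs⟩⟩, by rw [hf]⟩
  have h2 : Im (w ++ r) ⊆ Im w := by
    rintro _ ⟨u, rfl, h⟩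
    exact ⟨u ++ w ++ t ++ v, by simp [hr], h⟩
  -- By minimality, reading `r = t ++ (v ++ w)` maps `Im w` onto itself, hence permutes it.
  have h3 : Im (w ++ r) = Im w := Set.eq_of_subset_of_ncard_le h2 (hw _) (hfin w)
  rw [h3] at h1
  have h4 : Im w = f '' Im w :=
    Set.eq_of_subset_of_ncard_le h1 (Set.ncard_image_le (hfin w)) ((hfin w).image f)
  have hmaps : Set.MapsTo f (Im w) (Im w) := by
    intro q hq
    rw [h4]
    exact ⟨q, hq, rfl⟩
  have hinj : Set.InjOn f (Im w) := by
    rw [← Set.ncard_image_iff (hfin w), ← h4]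
  have hp : residual X (v ++ w) ∈ Im w := ⟨v, rfl, ⟨t, hvt⟩⟩
  -- The orbit of the state reached by `v ++ w` repeats, and injectivity moves the repetition back
  -- to the start.
  obtain ⟨i, j, hij, he⟩ := Set.Finite.exists_lt_map_eq_of_forall_mem
    (f := fun m => f^[m] (residual X (v ++ w))) (fun m => hmaps.iterate m hp) (hfin w)
  have hper : residual X (v ++ w) = f^[j - i] (residual X (v ++ w)) := by
    refine hinj.iterate hmaps i hp (hmaps.iterate _ hp) ?_
    rw [← Function.iterate_add_apply, Nat.add_sub_cancel' hij.le]
    exact he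
  rw [hf, residual_iterate] at hper
  have ht : t ∈ residual X (v ++ w) := hvt
  rw [hper] at ht
  have hx : (List.replicate (j - i + 1) (v ++ w ++ t)).flatten ∈ X := by
    have : v ++ w ++ (List.replicate (j - i) r).flatten ++ t ∈ X := ht
    rw [hr, List.append_assoc, flatten_replicate_append_comm, ← List.append_assoc] at this
    rwa [List.replicate_succ, List.flatten_cons]
  -- This power of `v ++ w ++ t` is one word of `X` and also a product of `j - i + 1 ≥ 2` words of
  -- `X`.
  have := hX [_] (List.replicate (j - i + 1) (v ++ w ++ t)) (by simpa using hx)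
    (fun x hx => by rw [List.eq_of_mem_replicate hx]; exact hvt) (by simp)
  have := congrArg List.length this
  simp at this
  omega

end Thin

/-! ### Bernoulli weights: complete regular codes are maximal. -/

section Measure

open scoped ENNReal

variable {A : Type*}

/-- The weight of a word under the uniform Bernoulli distribution. -/
noncomputable def weight (w : List A) : ℝ≥0∞ := (Nat.card A : ℝ≥0∞)⁻¹ ^ w.length

/-- The total weight of a set of words. -/
noncomputable def totalWeight (S : Set (List A)) : ℝ≥0∞ := ∑' w : S, weight (w : List A)

theorem weight_append (u v : List A) : weight (u ++ v) = weight u * weight v := by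
  simp [weight, pow_add]

theorem weight_ne_zero (w : List A) : weight w ≠ 0 := by
  simp [weight]

/-- The weight is multiplicative, and products of n + 1 factors are the image of `X` times the
products of n factors. Only an upper bound is needed, so repeated products do no harm. -/
theorem totalWeight_star_le (X : Set (List A)) :
    totalWeight (star X) ≤ ∑' n : ℕ, totalWeight X ^ n := by
  let P : ℕ → Set (List A) := fun n =>
    {w | ∃ L : List (List A), L.length = n ∧ (∀ x ∈ L, x ∈ X) ∧ L.flatten = w}
  have hP : star X = ⋃ n, P n := by
    ext w
    simp [star, P]
  have hle : ∀ n, totalWeight (P n) ≤ totalWeight X ^ n := by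
    intro n
    induction n with
    | zero =>
      have : P 0 = {[]} := by
        ext w
        simp only [P, Set.mem_ofPred_eq, List.length_eq_zero_iff, Set.mem_singleton_iff]
        constructor
        · rintro ⟨L, rfl, -, rfl⟩
          rfl
        · rintro rfl
          exact ⟨[], rfl, by simp, rfl⟩
      rw [this, totalWeight]
      simp [weight]
    | succ n ih =>
      let f : X × P n → P (n + 1) := fun p => ⟨p.1.1 ++ p.2.1, by
        obtain ⟨⟨x, hx⟩, ⟨_, L, hL, hL', rfl⟩⟩ := p
        exact ⟨x :: L, by simp [hL], by simpa using ⟨hx, hL'⟩, rfl⟩⟩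
      have hf : Function.Surjective f := by
        rintro ⟨_, L, hL, hL', rfl⟩
        cases L with
        | nil => simp at hL
        | cons x L =>
          rw [List.forall_mem_cons] at hL'
          exact ⟨(⟨x, hL'.1⟩, ⟨L.flatten, L, by simpa using hL, hL'.2, rfl⟩), rfl⟩
      calc totalWeight (P (n + 1))
          ≤ ∑' p : X × P n, weight (f p : List A) :=
            ENNReal.tsum_le_tsum_comp_of_surjective hf fun w => weight (w : List A)
        _ = totalWeight X * totalWeight (P n) := by
            simp only [f, weight_append]
            rw [ENNReal.tsum_prod']
            simp only [ENNReal.tsum_mul_left, ENNReal.tsum_mul_right, totalWeight]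
        _ ≤ totalWeight X ^ (n + 1) := by
            rw [pow_succ']
            gcongr
  rw [hP]
  exact (ENNReal.tsum_iUnion_le_tsum _ _).trans (ENNReal.tsum_le_tsum hle)

/-- No single factor can cover `w`, so every factorization has a cut within `w` or at one of its
ends. -/
theorem exists_append_mem_star_of_not_infix {X : Set (List A)} {w : List A}
    (hw : ∀ u v, u ++ w ++ v ∉ X) {t r : List A} (h : t ++ w ++ r ∈ star X) :
    ∃ w₁ w₂, w = w₁ ++ w₂ ∧ t ++ w₁ ∈ star X ∧ w₂ ++ r ∈ star X := by
  rw [List.append_assoc] at h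
  rcases append_mem_star_iff.1 h with ⟨h1, h2⟩ | ⟨t₁, t₂, v₁, v₂, rfl, h1, h2, h3, h4⟩
  · exact ⟨[], w, rfl, by simpa using h1, h2⟩
  · rcases List.append_eq_append_iff.1 h1 with ⟨e, rfl, -⟩ | ⟨e, rfl, rfl⟩
    · exact absurd (by simpa using h3) (hw t₂ e)
    · exact ⟨v₁, e, rfl, by simpa using append_mem_star h2 (subset_star X h3), h4⟩

variable [Finite A] [Nonempty A]

/-- The total weight is the supremum over finite subsets, each of which obeys the Kraft-McMillan
inequality. -/
theorem totalWeight_le_one {S : Set (List A)} (hS : UniquelyDecodable S) : totalWeight S ≤ 1 := by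
  classical
  have := Fintype.ofFinite A
  rw [totalWeight, ENNReal.tsum_eq_iSup_sum]
  refine iSup_le fun T => ?_
  have hT : UniquelyDecodable ((T.map (Function.Embedding.subtype _) : Finset (List A)) :
      Set (List A)) := by
    have hsub : ((T.map (Function.Embedding.subtype _) : Finset (List A)) : Set (List A)) ⊆ S := by
      intro x hx
      simp at hx
      exact hx.1
    exact fun L K hL hK => hS L K (fun w hw => hsub (hL w hw)) (fun w hw => hsub (hK w hw))
  have h := kraft_mcmillan_inequality hT
  rw [Finset.sum_map] at h
  have hw : ∀ w : List A, weight w = ENNReal.ofReal ((1 / Fintype.card A : ℝ) ^ w.length) := by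
    intro w
    have : (0 : ℝ) < Fintype.card A := by exact_mod_cast Fintype.card_pos
    rw [weight, ENNReal.ofReal_pow (by positivity), one_div, ENNReal.ofReal_inv_of_pos this,
      ENNReal.ofReal_natCast, Nat.card_eq_fintype_card]
  simp only [hw]
  rw [← ENNReal.ofReal_sum_of_nonneg (fun _ _ => by positivity)]
  exact ENNReal.ofReal_le_one.2 h

theorem totalWeight_lt_one_of_insert {X : Set (List A)} {z : List A} (hz : z ∉ X)
    (h : UniquelyDecodable (insert z X)) : totalWeight X < 1 := by
  have h1 := totalWeight_le_one h
  have h2 : totalWeight (insert z X) = weight z + totalWeight X := by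
    rw [totalWeight, totalWeight, Set.insert_eq,
      Summable.tsum_union_disjoint (by simpa using hz) ENNReal.summable ENNReal.summable]
    simp
  rw [h2] at h1
  have h3 : totalWeight X ≠ ∞ := by
    intro h
    rw [h] at h1
    simp at h1
  calc totalWeight X < totalWeight X + weight z := ENNReal.lt_add_right h3 (weight_ne_zero z)
    _ ≤ 1 := by rwa [add_comm]

/-- The words of each fixed length have total weight 1. -/
theorem totalWeight_univ : totalWeight (Set.univ : Set (List A)) = ∞ := by
  have := Fintype.ofFinite A
  have hc : (Fintype.card A : ℝ≥0∞) ≠ 0 := by exact_mod_cast Fintype.card_pos.ne'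
  rw [totalWeight, tsum_univ weight, ← List.equivSigmaTuple.symm.tsum_eq, ENNReal.tsum_sigma']
  have : ∀ n : ℕ, ∑' f : Fin n → A, weight (List.equivSigmaTuple.symm ⟨n, f⟩) = 1 := by
    intro n
    rw [tsum_fintype]
    simp only [List.equivSigmaTuple, Equiv.coe_fn_symm_mk, weight, List.length_ofFn,
      Nat.card_eq_fintype_card, Finset.sum_const, Finset.card_univ, Fintype.card_fun,
      Fintype.card_fin, nsmul_eq_mul, Nat.cast_pow]
    rw [← mul_pow, ENNReal.mul_inv_cancel hc (by simp), one_pow]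
  simp only [this]
  exact ENNReal.tsum_const_eq_top_of_ne_zero one_ne_zero

/-- A complete regular code is maximal as a code. -/
theorem not_uniquelyDecodable_insert_of_complete {X : Set (List A)} {n : ℕ} (hn : HasIndex X n)
    (hX : UniquelyDecodable X) (hc : Complete X) {z : List A} (hz : z ∉ X) :
    ¬ UniquelyDecodable (insert z X) := by
  intro hU
  have hlt := totalWeight_lt_one_of_insert hz hU
  -- The inserted word has positive weight, so `X` weighs less than 1 and the geometric series
  -- converges.
  have hstar : totalWeight (star X) ≠ ∞ := by
    refine ne_top_of_le_ne_top ?_ (totalWeight_star_le X)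
    rw [ENNReal.tsum_geometric, ENNReal.inv_ne_top]
    exact (tsub_pos_of_lt hlt).ne'
  obtain ⟨w, hw⟩ := exists_not_infix_of_uniquelyDecodable hn hX
  let T : Fin (w.length + 1) × Fin (w.length + 1) → Set (List A) := fun p =>
    {v | w.drop p.1 ++ v ++ w.take p.2 ∈ star X}
  -- By completeness `w ++ v ++ w` extends to a word of X*, whose factorization is cut in both
  -- copies of `w`. What lies between is `v` flanked by a suffix and a prefix of `w`, for which
  -- there are finitely many choices.
  have hcover : (Set.univ : Set (List A)) = ⋃ p, T p := by
    refine (Set.eq_univ_of_forall fun v => ?_).symm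
    obtain ⟨g, h, hgh⟩ := hc (w ++ v ++ w)
    obtain ⟨w₁, w₂, e1, -, h2⟩ := exists_append_mem_star_of_not_infix hw (t := g)
      (r := v ++ w ++ h) (by simpa using hgh)
    obtain ⟨w₃, w₄, e2, h3, -⟩ := exists_append_mem_star_of_not_infix hw (t := w₂ ++ v)
      (r := h) (by simpa using h2)
    rw [Set.mem_iUnion]
    refine ⟨(⟨w₁.length, by simp [e1]⟩, ⟨w₃.length, by simp [e2]⟩), ?_⟩
    have d1 : w.drop w₁.length = w₂ := by rw [e1]; simp
    have d2 : w.take w₃.length = w₃ := by rw [e2]; simp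
    simpa [T, d1, d2] using h3
  -- Adding the fixed flanks embeds `T p` in X* and scales its weight by a nonzero factor. Finitely
  -- many such sets cannot cover all words, whose weight is infinite.
  have hT : ∀ p, totalWeight (T p) ≠ ∞ := by
    intro p htop
    have h1 : weight (w.drop p.1) * totalWeight (T p) * weight (w.take p.2) ≤
        totalWeight (star X) := by
      rw [totalWeight, ← ENNReal.tsum_mul_left, ← ENNReal.tsum_mul_right]
      simp only [← weight_append]
      exact ENNReal.tsum_comp_le_tsum_of_injective
        (f := fun v : T p => (⟨w.drop p.1 ++ v ++ w.take p.2, v.2⟩ : star X))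
        (fun v v' h => Subtype.ext (by simpa using h)) fun w => weight (w : List A)
    rw [htop, ENNReal.mul_top (weight_ne_zero _), ENNReal.top_mul (weight_ne_zero _)] at h1
    exact hstar (top_le_iff.1 h1)
  have h1 := ENNReal.tsum_iUnion_le (weight (A := A)) T
  have h2 : totalWeight (⋃ p, T p) = ∞ := by rw [← hcover, totalWeight_univ]
  rw [totalWeight] at h2
  rw [h2, top_le_iff, ENNReal.sum_eq_top] at h1
  obtain ⟨p, -, hp⟩ := h1
  exact hT p hp

end Measure

/-- An incomplete independent code can be enlarged within the independent codes; a complete regular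
code is contained in no larger code, independent or not. -/
theorem maximalIndependentCode_iff {A : Type*} [Finite A] [Nontrivial A] {X : Set (List A)}
    {n : ℕ} (hn : HasIndex X n) (hX : UniquelyDecodable X) {C : ℕ → ℕ → ℕ → ℕ → Prop} {k K : ℕ}
    (hC : ∀ d i s, C k d i s → d ≤ K ∧ i ≤ K ∧ s ≤ K) :
    (editRel C k).MaximalIndependentCode X ↔ (editRel C k).Independent X ∧ Complete X := by
  constructor
  · intro h
    refine ⟨h.prop.2, ?_⟩
    by_contra hc
    obtain ⟨z, hz, h1⟩ := exists_insert_of_not_complete hX hc hC h.prop.2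
    exact hz (h.le_of_ge h1 (Set.subset_insert z X) (Set.mem_insert z X))
  · rintro ⟨hi, hc⟩
    refine ⟨⟨hX, hi⟩, fun Y hY hXY z hzY => ?_⟩
    by_contra hz
    refine not_uniquelyDecodable_insert_of_complete hn hX hc hz ?_
    have hsub : insert z X ⊆ Y := Set.insert_subset hzY hXY
    exact fun L K hL hK => hY.1 L K (fun w hw => hsub (hL w hw)) (fun w hw => hsub (hK w hw))

/-! ### Primitive recursive search over words of bounded length. -/

section BoundedSearch

variable {α β : Type*} [Primcodable α] [Primcodable β]

theorem primrecPred_exists_mem {p : α → β → Prop} (hp : PrimrecRel p) {f : α → List β}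
    (hf : Primrec f) : PrimrecPred fun a => ∃ b ∈ f a, p a b :=
  PrimrecRel.comp (PrimrecRel.exists_mem_list (PrimrecRel.swap hp)) hf Primrec.id

theorem primrecPred_forall_mem {p : α → β → Prop} (hp : PrimrecRel p) {f : α → List β}
    (hf : Primrec f) : PrimrecPred fun a => ∀ b ∈ f a, p a b :=
  PrimrecRel.comp (PrimrecRel.forall_mem_list (PrimrecRel.swap hp)) hf Primrec.id

theorem primrec₂_pow : Primrec₂ ((· ^ ·) : ℕ → ℕ → ℕ) := by
  refine (Primrec.nat_rec (Primrec.const 1)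
    (Primrec.nat_mul.comp (Primrec.snd.comp Primrec.snd) Primrec.fst).to₂).of_eq ?_
  intro a n
  induction n with
  | zero => simp
  | succ n ih => simp only [pow_succ, ← ih]

/-- The words of length at most `n` over the letters listed in `S`. -/
def wordsUpTo {β : Type*} (S : List β) : ℕ → List (List β)
  | 0 => [[]]
  | n + 1 => [] :: S.flatMap fun b => (wordsUpTo S n).map (b :: ·)

theorem mem_wordsUpTo {β : Type*} {S : List β} {n : ℕ} {w : List β} :
    w ∈ wordsUpTo S n ↔ w.length ≤ n ∧ ∀ b ∈ w, b ∈ S := by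
  induction n generalizing w with
  | zero =>
    simp only [wordsUpTo, List.mem_singleton, Nat.le_zero, List.length_eq_zero_iff]
    exact ⟨fun h => ⟨h, by simp [h]⟩, fun h => h.1⟩
  | succ n ih =>
    simp only [wordsUpTo, List.mem_cons, List.mem_flatMap, List.mem_map, ih]
    cases w with
    | nil => simp
    | cons c w =>
      simp only [reduceCtorEq, List.cons.injEq, false_or, List.length_cons,
        Nat.add_le_add_iff_right, List.forall_mem_cons]
      constructor
      · rintro ⟨b, hb, v, ⟨h1, h2⟩, rfl, rfl⟩
        exact ⟨h1, hb, h2⟩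
      · rintro ⟨h1, hb, h2⟩
        exact ⟨c, hb, w, ⟨h1, h2⟩, rfl, rfl⟩

theorem primrec₂_wordsUpTo : Primrec₂ (wordsUpTo : List β → ℕ → List (List β)) := by
  have hmap : Primrec₂ fun (a : List β × ℕ × List (List β)) (b : β) => a.2.2.map (b :: ·) :=
    Primrec.list_map (Primrec.snd.comp (Primrec.snd.comp Primrec.fst))
      (Primrec.list_cons.comp (Primrec.snd.comp Primrec.fst) Primrec.snd).to₂
  have hstep : Primrec₂ fun (S : List β) (q : ℕ × List (List β)) =>
      [] :: S.flatMap fun b => q.2.map (b :: ·) :=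
    Primrec.list_cons.comp (Primrec.const []) (Primrec.list_flatMap Primrec.fst hmap)
  refine (Primrec.nat_rec (Primrec.const [[]]) hstep).of_eq ?_
  intro S n
  induction n with
  | zero => rfl
  | succ n ih => simp only [wordsUpTo, ← ih]

theorem exists_forall_mem_list (E : Type*) [Finite E] : ∃ S : List E, ∀ e, e ∈ S := by
  have := Fintype.ofFinite E
  exact ⟨Finset.univ.toList, by simp⟩

theorem primrecPred_exists_length_lt {E : Type*} [Finite E] [Primcodable E]
    {p : α → List E → Prop} (hp : PrimrecRel p) {f : α → ℕ} (hf : Primrec f) :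
    PrimrecPred fun a => ∃ w : List E, w.length < f a ∧ p a w := by
  obtain ⟨S, hS⟩ := exists_forall_mem_list E
  have h : PrimrecRel fun (a : α) (w : List E) => w.length < f a ∧ p a w :=
    PrimrecPred.and (Primrec.nat_lt.comp (Primrec.list_length.comp Primrec.snd)
      (hf.comp Primrec.fst)) hp
  refine (primrecPred_exists_mem h (primrec₂_wordsUpTo.comp (Primrec.const S) hf)).of_eq ?_
  intro a
  simp only [mem_wordsUpTo, hS, implies_true, and_true]
  exact ⟨fun ⟨w, _, h⟩ => ⟨w, h⟩, fun ⟨w, h⟩ => ⟨w, h.1.le, h⟩⟩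

theorem primrecPred_forall_length_lt {E : Type*} [Finite E] [Primcodable E]
    {p : α → List E → Prop} (hp : PrimrecRel p) {f : α → ℕ} (hf : Primrec f) :
    PrimrecPred fun a => ∀ w : List E, w.length < f a → p a w :=
  (primrecPred_exists_length_lt hp.not hf).not.of_eq fun a => by simp

end BoundedSearch

/-! ### Primitive recursive membership, unique decodability and completeness. -/

section Membership

variable {A : Type*}

theorem exists_nonempty_factors_of_mem_star {Y : Set (List A)} {w : List A} (h : w ∈ star Y) :
    ∃ L : List (List A), (∀ x ∈ L, x ∈ Y ∧ x ≠ []) ∧ L.flatten = w := by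
  obtain ⟨L, hL, rfl⟩ := h
  induction L with
  | nil => exact ⟨[], by simp, rfl⟩
  | cons y L ih =>
    rw [List.forall_mem_cons] at hL
    obtain ⟨K, hK, h⟩ := ih hL.2
    by_cases hy : y = []
    · exact ⟨K, hK, by simpa [hy] using h⟩
    · exact ⟨y :: K, List.forall_mem_cons.2 ⟨⟨hL.1, hy⟩, hK⟩, by simp [h]⟩

theorem length_le_flatten_length {L : List (List A)} (hL : ∀ x ∈ L, x ≠ []) :
    L.length ≤ L.flatten.length ∧ ∀ x ∈ L, x.length ≤ L.flatten.length := by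
  induction L with
  | nil => simp
  | cons y L ih =>
    rw [List.forall_mem_cons] at hL
    have := List.length_pos_iff.2 hL.1
    obtain ⟨h1, h2⟩ := ih hL.2
    simp only [List.length_cons, List.flatten_cons, List.length_append, List.forall_mem_cons]
    exact ⟨by omega, by omega, fun x hx => (h2 x hx).trans (by omega)⟩

/-- Once empty factors are dropped, both the number of factors and their lengths are at most the
length of the word, so finitely many factorizations need checking. -/
theorem primrecRel_mem_star [Finite A] [Primcodable A] {α : Type*} [Primcodable α]
    {Y : α → Set (List A)} (hY : PrimrecRel fun a w => w ∈ Y a) :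
    PrimrecRel fun a w => w ∈ star (Y a) := by
  obtain ⟨S, hS⟩ := exists_forall_mem_list A
  have hlen : Primrec fun q : α × List A => q.2.length := Primrec.list_length.comp Primrec.snd
  have hall : PrimrecRel fun (q : α × List A) (L : List (List A)) => ∀ x ∈ L, x ∈ Y q.1 :=
    primrecPred_forall_mem (p := fun (r : (α × List A) × List (List A)) x => x ∈ Y r.1.1)
      (hY.comp (Primrec.fst.comp (Primrec.fst.comp Primrec.fst)) Primrec.snd) Primrec.snd
  have hp : PrimrecRel fun (q : α × List A) (L : List (List A)) =>
      (∀ x ∈ L, x ∈ Y q.1) ∧ L.flatten = q.2 :=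
    PrimrecPred.and hall (Primrec.eq.comp (Primrec.list_flatten.comp Primrec.snd)
      (Primrec.snd.comp Primrec.fst))
  refine (primrecPred_exists_mem hp (primrec₂_wordsUpTo.comp
    (primrec₂_wordsUpTo.comp (Primrec.const S) hlen) hlen)).of_eq ?_
  rintro ⟨a, w⟩
  simp only [mem_wordsUpTo, hS, implies_true, and_true]
  constructor
  · rintro ⟨L, -, hL, rfl⟩
    exact ⟨L, hL, rfl⟩
  · intro h
    obtain ⟨L, hL, rfl⟩ := exists_nonempty_factors_of_mem_star h
    exact ⟨L, length_le_flatten_length fun x hx => (hL x hx).2, fun x hx => (hL x hx).1, rfl⟩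

theorem primrecPred_uniquelyDecodable [Finite A] [Primcodable A] {α : Type*} [Primcodable α]
    {Y : α → Set (List A)} (hY : PrimrecRel fun a w => w ∈ Y a) {n : α → ℕ} (hn : Primrec n)
    (h : ∀ a, HasIndex (Y a) (n a)) : PrimrecPred fun a => UniquelyDecodable (Y a) := by
  have hstar := primrecRel_mem_star hY
  have hm : Primrec fun a => 2 ^ n a * 2 :=
    Primrec.nat_mul.comp (primrec₂_pow.comp (Primrec.const 2) hn) (Primrec.const 2)
  have ha : Primrec fun r : ((α × List A) × List A) × List A => r.1.1.1 :=
    Primrec.fst.comp (Primrec.fst.comp Primrec.fst)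
  have ht : PrimrecRel fun (q : (α × List A) × List A) (t : List A) =>
      t ∈ star (Y q.1.1) ∧ q.2 ++ t ∈ star (Y q.1.1) :=
    PrimrecPred.and (hstar.comp ha Primrec.snd)
      (hstar.comp ha (Primrec.list_append.comp (Primrec.snd.comp Primrec.fst) Primrec.snd))
  have hs : PrimrecRel fun (q : α × List A) (s : List A) => (q.2 ++ s ∈ Y q.1 ∧ s ≠ []) ∧
      ∃ t : List A, t.length < (2 ^ n q.1 * 2) * (2 ^ n q.1 * 2) ∧
        t ∈ star (Y q.1) ∧ s ++ t ∈ star (Y q.1) := by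
    refine PrimrecPred.and (PrimrecPred.and ?_ ?_) (primrecPred_exists_length_lt ht ?_)
    · exact hY.comp (Primrec.fst.comp Primrec.fst)
        (Primrec.list_append.comp (Primrec.snd.comp Primrec.fst) Primrec.snd)
    · exact (Primrec.eq.comp Primrec.snd (Primrec.const [])).not
    · exact (Primrec.nat_mul.comp hm hm).comp (Primrec.fst.comp Primrec.fst)
  have hx : PrimrecRel fun (a : α) (x : List A) => x ∈ Y a ∧
      ∃ s : List A, s.length < n a * 2 * (2 ^ n a * 2) ∧ (x ++ s ∈ Y a ∧ s ≠ []) ∧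
        ∃ t : List A, t.length < (2 ^ n a * 2) * (2 ^ n a * 2) ∧ t ∈ star (Y a) ∧
          s ++ t ∈ star (Y a) :=
    PrimrecPred.and hY (primrecPred_exists_length_lt hs ((Primrec.nat_mul.comp
      (Primrec.nat_mul.comp hn (Primrec.const 2)) hm).comp Primrec.fst))
  refine (PrimrecPred.and (hY.comp Primrec.id (Primrec.const [])).not
    (primrecPred_exists_length_lt hx hn).not).of_eq fun a => ?_
  exact (uniquelyDecodable_iff_bounded (h a) (h a).star).symm

theorem primrecPred_complete [Finite A] [Primcodable A] {α : Type*} [Primcodable α]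
    {Y : α → Set (List A)} (hY : PrimrecRel fun a w => w ∈ Y a) {n : α → ℕ} (hn : Primrec n)
    (h : ∀ a, HasIndex (Y a) (n a)) : PrimrecPred fun a => Complete (Y a) := by
  have hstar := primrecRel_mem_star hY
  have hm : Primrec fun a => 2 ^ n a * 2 :=
    Primrec.nat_mul.comp (primrec₂_pow.comp (Primrec.const 2) hn) (Primrec.const 2)
  have hv : PrimrecRel fun (q : (α × List A) × List A) (v : List A) =>
      q.2 ++ q.1.2 ++ v ∈ star (Y q.1.1) :=
    hstar.comp (Primrec.fst.comp (Primrec.fst.comp Primrec.fst))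
      (Primrec.list_append.comp (Primrec.list_append.comp (Primrec.snd.comp Primrec.fst)
        (Primrec.snd.comp (Primrec.fst.comp Primrec.fst))) Primrec.snd)
  have hv' : PrimrecRel fun (q : α × List A) (u : List A) =>
      ∃ v : List A, v.length < 2 ^ n q.1 * 2 ∧ u ++ q.2 ++ v ∈ star (Y q.1) :=
    primrecPred_exists_length_lt hv (hm.comp (Primrec.fst.comp Primrec.fst))
  have hu : PrimrecRel fun (a : α) (w : List A) => ∃ u : List A, u.length < 2 ^ n a * 2 ∧
      ∃ v : List A, v.length < 2 ^ n a * 2 ∧ u ++ w ++ v ∈ star (Y a) :=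
    primrecPred_exists_length_lt hv' (hm.comp Primrec.fst)
  refine (primrecPred_forall_length_lt hu
    (primrec₂_pow.comp (Primrec.const 2) hm)).of_eq fun a => ?_
  exact (complete_iff_bounded (h a).star).symm

/-- The numbers of deletions, insertions and substitutions in an edit script. -/
noncomputable def scriptCost (e : List (Option A × Option A)) : ℕ × ℕ × ℕ := by
  classical
  exact ((e.filter fun p => p.1 ≠ none ∧ p.2 = none).length,
    (e.filter fun p => p.1 = none ∧ p.2 ≠ none).length,
    (e.filter fun p => (p.1 ≠ none ∧ p.2 ≠ none) ∧ p.1 ≠ p.2).length)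

theorem primrec_scriptCost [Primcodable A] : Primrec (scriptCost (A := A)) := by
  classical
  have h1 : PrimrecPred fun p : Option A × Option A => p.1 = none :=
    Primrec.eq.comp Primrec.fst (Primrec.const none)
  have h2 : PrimrecPred fun p : Option A × Option A => p.2 = none :=
    Primrec.eq.comp Primrec.snd (Primrec.const none)
  have h3 : PrimrecPred fun p : Option A × Option A => p.1 = p.2 :=
    Primrec.eq.comp Primrec.fst Primrec.snd
  exact Primrec.pair (Primrec.list_length.comp (Primrec.listFilter (h1.not.and h2)))
    (Primrec.pair (Primrec.list_length.comp (Primrec.listFilter (h1.and h2.not)))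
      (Primrec.list_length.comp (Primrec.listFilter ((h1.not.and h2.not).and h3.not))))

/-- Each column of the script consumes a letter of `x` or of `y`, whence the length bound. -/
theorem Align.exists_script {x y : List A} {d i s : ℕ} (h : Align x y d i s) :
    ∃ e : List (Option A × Option A), e.length < x.length + y.length + 1 ∧
      e.filterMap Prod.fst = x ∧ e.filterMap Prod.snd = y ∧ scriptCost e = (d, i, s) := by
  induction h with
  | nil => exact ⟨[], by simp [scriptCost]⟩
  | keep a _ ih =>
    obtain ⟨e, h1, rfl, rfl, h4⟩ := ih
    refine ⟨(some a, some a) :: e, ?_, rfl, rfl, ?_⟩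
    · simp at h1 ⊢; omega
    · simpa [scriptCost] using h4
  | del a _ ih =>
    obtain ⟨e, h1, rfl, rfl, h4⟩ := ih
    refine ⟨(some a, none) :: e, ?_, rfl, rfl, ?_⟩
    · simp at h1 ⊢; omega
    · simpa [scriptCost] using h4
  | ins a _ ih =>
    obtain ⟨e, h1, rfl, rfl, h4⟩ := ih
    refine ⟨(none, some a) :: e, ?_, rfl, rfl, ?_⟩
    · simp at h1 ⊢; omega
    · simpa [scriptCost] using h4
  | @sub a b _ _ _ _ _ hab _ ih =>
    obtain ⟨e, h1, rfl, rfl, h4⟩ := ih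
    refine ⟨(some a, some b) :: e, ?_, rfl, rfl, ?_⟩
    · simp at h1 ⊢; omega
    · simpa [scriptCost, hab] using h4

theorem align_of_script (e : List (Option A × Option A)) :
    Align (e.filterMap Prod.fst) (e.filterMap Prod.snd) (scriptCost e).1 (scriptCost e).2.1
      (scriptCost e).2.2 := by
  induction e with
  | nil => simpa [scriptCost] using Align.nil
  | cons p e ih =>
    obtain ⟨a, b⟩ := p
    rcases a with _ | a <;> rcases b with _ | b
    -- An arbitrary script may contain empty columns; they contribute no letter and no cost.
    · simpa [scriptCost] using ih
    · simpa [scriptCost] using ih.ins b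
    · simpa [scriptCost] using ih.del a
    · by_cases hab : a = b
      · subst hab
        simpa [scriptCost] using ih.keep a
      · simpa [scriptCost, hab] using ih.sub hab

theorem primrecPred_mem_editRel [Finite A] [Primcodable A] {C : ℕ → ℕ → ℕ → ℕ → Prop}
    (hC : PrimrecPred fun q : ℕ × ℕ × ℕ × ℕ => C q.1 q.2.1 q.2.2.1 q.2.2.2) :
    PrimrecPred fun q : ℕ × List A × List A => (q.2.1, q.2.2) ∈ editRel C q.1 := by
  have hx : Primrec fun q : ℕ × List A × List A => q.2.1 := Primrec.fst.comp Primrec.snd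
  have hy : Primrec fun q : ℕ × List A × List A => q.2.2 := Primrec.snd.comp Primrec.snd
  have hfst : Primrec fun e : List (Option A × Option A) => e.filterMap Prod.fst :=
    Primrec.listFilterMap Primrec.id (Primrec.fst.comp Primrec.snd).to₂
  have hsnd : Primrec fun e : List (Option A × Option A) => e.filterMap Prod.snd :=
    Primrec.listFilterMap Primrec.id (Primrec.snd.comp Primrec.snd).to₂
  have hp : PrimrecRel fun (q : ℕ × List A × List A) (e : List (Option A × Option A)) =>
      (e.filterMap Prod.fst = q.2.1 ∧ e.filterMap Prod.snd = q.2.2) ∧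
        C q.1 (scriptCost e).1 (scriptCost e).2.1 (scriptCost e).2.2 := by
    refine PrimrecPred.and (PrimrecPred.and ?_ ?_) ?_
    · exact Primrec.eq.comp (hfst.comp Primrec.snd) (hx.comp Primrec.fst)
    · exact Primrec.eq.comp (hsnd.comp Primrec.snd) (hy.comp Primrec.fst)
    · exact hC.comp (Primrec.pair (Primrec.fst.comp Primrec.fst)
        (primrec_scriptCost.comp Primrec.snd))
  have hlen : Primrec fun q : ℕ × List A × List A => q.2.1.length + q.2.2.length + 1 :=
    Primrec.succ.comp (Primrec.nat_add.comp (Primrec.list_length.comp hx)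
      (Primrec.list_length.comp hy))
  refine ((Primrec.eq.comp hx hy).not.and (primrecPred_exists_length_lt hp hlen)).of_eq ?_
  rintro ⟨k, x, y⟩
  rw [mem_editRel]
  refine and_congr_right fun _ => ?_
  constructor
  · rintro ⟨e, -, ⟨rfl, rfl⟩, hc⟩
    exact ⟨_, _, _, hc, align_of_script e⟩
  · rintro ⟨d, i, s, hc, hal⟩
    obtain ⟨e, h1, h2, h3, h4⟩ := hal.exists_script
    exact ⟨e, h1, ⟨h2, h3⟩, by rw [h4]; exact hc⟩

end Membership

/-! ### Simulation of automata and a bound on their index. -/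

namespace FinAut

variable {A : Type*}

/-- The states reached from the states in `S` by reading the letter `a`. -/
noncomputable def stepList (M : FinAut A) (S : List ℕ) (a : A) : List ℕ := by
  classical
  exact M.2.1.filterMap fun t => if t.1 ∈ S ∧ t.2.1 = a then some t.2.2 else none

/-- The states reached from the initial states by reading the word `w`. -/
noncomputable def evalList (M : FinAut A) (w : List A) : List ℕ := w.foldl M.stepList M.1

theorem mem_evalList (M : FinAut A) (w : List A) (q : ℕ) :
    q ∈ M.evalList w ↔ q ∈ M.toNFA.eval w := by
  induction w using List.reverseRecOn generalizing q with
  | nil => simp [evalList, toNFA]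
  | append_singleton w a ih =>
    rw [NFA.eval_append_singleton, NFA.mem_stepSet, evalList, List.foldl_append]
    simp only [List.foldl_cons, List.foldl_nil, stepList, List.mem_filterMap,
      Option.ite_none_right_eq_some, Option.some.injEq]
    constructor
    · rintro ⟨⟨p, b, q'⟩, ht, ⟨hp, rfl⟩, rfl⟩
      exact ⟨p, (ih p).1 hp, ht⟩
    · rintro ⟨p, hp, ht⟩
      exact ⟨(p, a, q), ht, ⟨(ih p).2 hp, rfl⟩, rfl⟩

theorem mem_lang (M : FinAut A) (w : List A) :
    w ∈ M.lang ↔ ∃ q ∈ M.evalList w, ∃ f ∈ M.2.2, f = q := by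
  simp only [exists_eq_right, mem_evalList]
  change w ∈ M.toNFA.accepts ↔ _
  rw [NFA.mem_accepts]
  exact ⟨fun ⟨q, h1, h2⟩ => ⟨q, h2, h1⟩, fun ⟨q, h1, h2⟩ => ⟨q, h2, h1⟩⟩

theorem primrec_stepList [Primcodable A] :
    Primrec fun q : FinAut A × List ℕ × A => q.1.stepList q.2.1 q.2.2 := by
  classical
  have hmem : PrimrecPred fun r : (FinAut A × List ℕ × A) × (ℕ × A × ℕ) => r.2.1 ∈ r.1.2.1 := by
    refine (primrecPred_exists_mem (f := fun r : (FinAut A × List ℕ × A) × (ℕ × A × ℕ) => r.1.2.1)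
      (p := fun r s => s = r.2.1) ?_ ?_).of_eq (by simp)
    · exact Primrec.eq.comp Primrec.snd (Primrec.fst.comp (Primrec.snd.comp Primrec.fst))
    · exact Primrec.fst.comp (Primrec.snd.comp Primrec.fst)
  have heq : PrimrecPred fun r : (FinAut A × List ℕ × A) × (ℕ × A × ℕ) => r.2.2.1 = r.1.2.2 :=
    Primrec.eq.comp (Primrec.fst.comp (Primrec.snd.comp Primrec.snd))
      (Primrec.snd.comp (Primrec.snd.comp Primrec.fst))
  have hite : Primrec₂ fun (q : FinAut A × List ℕ × A) (t : ℕ × A × ℕ) =>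
      if t.1 ∈ q.2.1 ∧ t.2.1 = q.2.2 then some t.2.2 else none :=
    Primrec.ite (hmem.and heq) (Primrec.option_some.comp
      (Primrec.snd.comp (Primrec.snd.comp Primrec.snd))) (Primrec.const none)
  exact Primrec.listFilterMap (Primrec.fst.comp (Primrec.snd.comp Primrec.fst)) hite

theorem primrecRel_mem_lang [Primcodable A] :
    PrimrecRel fun (M : FinAut A) (w : List A) => w ∈ M.lang := by
  have heval : Primrec fun q : FinAut A × List A => q.1.evalList q.2 := by
    refine Primrec.list_foldl (f := fun q : FinAut A × List A => q.2) (g := fun q => q.1.1)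
      (h := fun q r => q.1.stepList r.1 r.2) Primrec.snd (Primrec.fst.comp Primrec.fst) ?_
    exact primrec_stepList.comp (Primrec.pair (Primrec.fst.comp Primrec.fst) Primrec.snd)
  have hfin : PrimrecRel fun (q : FinAut A × List A) (s : ℕ) => ∃ f ∈ q.1.2.2, f = s :=
    primrecPred_exists_mem (p := fun (r : (FinAut A × List A) × ℕ) f => f = r.2)
      (Primrec.eq.comp Primrec.snd (Primrec.snd.comp Primrec.fst))
      (Primrec.snd.comp (Primrec.snd.comp (Primrec.fst.comp Primrec.fst)))
  exact (primrecPred_exists_mem hfin heval).of_eq fun q => (mem_lang q.1 q.2).symm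

/-- A bound on the number of left quotients of the recognized language. -/
def indexBound (M : FinAut A) : ℕ := 2 ^ (M.1.length + M.2.1.length)

theorem primrec_indexBound [Primcodable A] : Primrec (indexBound (A := A)) :=
  primrec₂_pow.comp (Primrec.const 2) (Primrec.nat_add.comp
    (Primrec.list_length.comp Primrec.fst)
    (Primrec.list_length.comp (Primrec.fst.comp Primrec.snd)))

/-- This is the subset construction. Every reached state is listed in `F`, and subsets of positions
of `F` are used, so that the bound depends only on the lengths of the lists. -/
theorem hasIndex_lang (M : FinAut A) : HasIndex M.lang M.indexBound := by
  let F : List ℕ := M.1 ++ M.2.1.map fun t => t.2.2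
  have hF : ∀ w q, q ∈ M.toNFA.eval w → q ∈ F := by
    intro w q hq
    induction w using List.reverseRecOn with
    | nil => exact List.mem_append_left _ hq
    | append_singleton w a _ =>
      rw [NFA.eval_append_singleton, NFA.mem_stepSet] at hq
      obtain ⟨p, -, hp⟩ := hq
      exact List.mem_append_right _ (List.mem_map.2 ⟨(p, a, q), hp, rfl⟩)
  have := HasIndex.of_finite (L := M.lang)
    (fun u => ({j | F[j] ∈ M.toNFA.eval u} : Set (Fin F.length))) (by
      intro u u' v h hu
      have he : M.toNFA.eval u = M.toNFA.eval u' := by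
        ext q
        constructor
        · intro hq
          obtain ⟨j, hj, rfl⟩ := List.getElem_of_mem (hF u q hq)
          exact (Set.ext_iff.1 h ⟨j, hj⟩).1 hq
        · intro hq
          obtain ⟨j, hj, rfl⟩ := List.getElem_of_mem (hF u' q hq)
          exact (Set.ext_iff.1 h ⟨j, hj⟩).2 hq
      change u' ++ v ∈ M.toNFA.accepts
      have hu : u ++ v ∈ M.toNFA.accepts := hu
      rw [NFA.mem_accepts, NFA.evalFrom_append] at hu ⊢
      change ∃ S ∈ M.toNFA.accept, S ∈ M.toNFA.evalFrom (M.toNFA.eval u') v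
      rw [← he]
      exact hu)
  simpa [Nat.card_eq_fintype_card, F, indexBound] using this

end FinAut

/-! ### Decision procedures for a family of edit relations. -/

theorem DecidableOn.of_primrecPred {α : Type*} [Primcodable α] {promise P D : α → Prop}
    (hD : PrimrecPred D) (h : ∀ a, promise a → (D a ↔ P a)) : DecidableOn promise P := by
  obtain ⟨_, hD⟩ := hD
  exact ⟨D, ⟨inferInstance, hD.to_comp⟩, h⟩

theorem DecidableOn.congr {α : Type*} [Primcodable α] {promise promise' P Q : α → Prop}
    (h : DecidableOn promise P) (hp : ∀ a, promise' a → promise a)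
    (hPQ : ∀ a, promise' a → (P a ↔ Q a)) : DecidableOn promise' Q := by
  obtain ⟨D, hD, h⟩ := h
  exact ⟨D, hD, fun a ha => (h a (hp a ha)).trans (hPQ a ha)⟩

/-- A primitive recursive family of admissible numbers of deletions, insertions and
substitutions, none of them exceeding `k + 1`. -/
structure IsEditFamily (C : ℕ → ℕ → ℕ → ℕ → Prop) : Prop where
  primrecPred : PrimrecPred fun q : ℕ × ℕ × ℕ × ℕ => C q.1 q.2.1 q.2.2.1 q.2.2.2
  le : ∀ k d i s, C k d i s → d ≤ k + 1 ∧ i ≤ k + 1 ∧ s ≤ k + 1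

namespace IsEditFamily

variable {A : Type*} {C : ℕ → ℕ → ℕ → ℕ → Prop}

theorem length_le (hC : IsEditFamily C) {k : ℕ} {x y : List A} (h : (x, y) ∈ editRel C k) :
    x.length ≤ y.length + (k + 1) ∧ y.length ≤ x.length + (k + 1) := by
  obtain ⟨-, d, i, s, hc, hal⟩ := mem_editRel.1 h
  have := hal.length_eq
  have := hC.le _ _ _ _ hc
  omega

theorem primrecRel_mem_lang [Primcodable A] :
    PrimrecRel fun (i : ℕ × FinAut A) (w : List A) => w ∈ i.2.lang :=
  FinAut.primrecRel_mem_lang.comp (Primrec.snd.comp Primrec.fst) Primrec.snd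

theorem primrec_langIndexBound [Primcodable A] : Primrec fun i : ℕ × FinAut A => i.2.indexBound :=
  FinAut.primrec_indexBound.comp Primrec.snd

/-- A bound on the number of left quotients of the image of the recognized language. -/
noncomputable def imageIndexBound (i : ℕ × FinAut A) : ℕ :=
  2 ^ (i.2.indexBound * ((i.1 + 1 + 1) * ((i.1 + 1 + 1) * ((i.1 + 1 + 1) *
    ((Nat.card A + 1) ^ (i.1 + 1) * (Nat.card A + 1) ^ (i.1 + 1) + 1)))))

theorem hasIndex_image [Finite A] (hC : IsEditFamily C) (i : ℕ × FinAut A) :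
    HasIndex ((editRel C i.1).image i.2.lang) (imageIndexBound i) :=
  i.2.hasIndex_lang.image_editRel (hC.le i.1)

theorem primrec_imageIndexBound [Primcodable A] : Primrec (imageIndexBound (A := A)) := by
  have hk : Primrec fun i : ℕ × FinAut A => i.1 + 1 := Primrec.succ.comp Primrec.fst
  have hk' : Primrec fun i : ℕ × FinAut A => i.1 + 1 + 1 := Primrec.succ.comp hk
  have hp : Primrec fun i : ℕ × FinAut A => (Nat.card A + 1) ^ (i.1 + 1) :=
    primrec₂_pow.comp (Primrec.const _) hk
  exact primrec₂_pow.comp (Primrec.const 2) (Primrec.nat_mul.comp primrec_langIndexBound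
    (Primrec.nat_mul.comp hk' (Primrec.nat_mul.comp hk' (Primrec.nat_mul.comp hk'
      (Primrec.succ.comp (Primrec.nat_mul.comp hp hp))))))

variable [Finite A] [Primcodable A]

theorem primrecRel_mem_image (hC : IsEditFamily C) :
    PrimrecRel fun (i : ℕ × FinAut A) (w : List A) => w ∈ (editRel C i.1).image i.2.lang := by
  have hp : PrimrecRel fun (q : (ℕ × FinAut A) × List A) (x : List A) =>
      x ∈ q.1.2.lang ∧ (x, q.2) ∈ editRel C q.1.1 := by
    refine PrimrecPred.and (primrecRel_mem_lang.comp (Primrec.fst.comp Primrec.fst) Primrec.snd) ?_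
    exact (primrecPred_mem_editRel hC.primrecPred).comp (Primrec.pair
      (Primrec.fst.comp (Primrec.fst.comp Primrec.fst))
      (Primrec.pair Primrec.snd (Primrec.snd.comp Primrec.fst)))
  -- Related words differ in length by at most `k + 1`; one more is added because the search bound
  -- is strict.
  have hl : Primrec fun q : (ℕ × FinAut A) × List A => q.2.length + (q.1.1 + 2) :=
    Primrec.nat_add.comp (Primrec.list_length.comp Primrec.snd)
      (Primrec.nat_add.comp (Primrec.fst.comp Primrec.fst) (Primrec.const 2))
  refine (primrecPred_exists_length_lt hp hl).of_eq ?_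
  rintro ⟨i, w⟩
  constructor
  · rintro ⟨x, -, hx, hxw⟩
    exact ⟨x, hx, hxw⟩
  · rintro ⟨x, hx, hxw⟩
    refine ⟨x, ?_, hx, hxw⟩
    have : x.length ≤ w.length + (i.1 + 1) := (hC.length_le hxw).1
    change x.length < w.length + (i.1 + 2)
    omega

theorem primrecPred_independent (hC : IsEditFamily C) :
    PrimrecPred fun i : ℕ × FinAut A => (editRel C i.1).Independent i.2.lang := by
  have hp : PrimrecRel fun (i : ℕ × FinAut A) (w : List A) =>
      w ∈ (editRel C i.1).image i.2.lang ∩ i.2.lang :=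
    PrimrecPred.and hC.primrecRel_mem_image primrecRel_mem_lang
  refine (primrecPred_exists_length_lt hp
    (Primrec.nat_mul.comp primrec_imageIndexBound primrec_langIndexBound)).not.of_eq fun i => ?_
  rw [WordRel.Independent, ← Set.not_nonempty_iff_eq_empty, not_iff_not]
  constructor
  · rintro ⟨w, -, h⟩
    exact ⟨w, h⟩
  · intro h
    obtain ⟨w, h1, h2⟩ := ((hC.hasIndex_image i).inter i.2.hasIndex_lang).exists_short h
    exact ⟨w, h2, h1⟩

/-- Finiteness makes every codeword shorter than the index, so all pairs of codewords are examined;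
a common image is at most `k + 1` letters longer than `y`. -/
theorem decidableOn_errorCorrecting (hC : IsEditFamily C) :
    DecidableOn FinAut.IsFiniteCodeInstance
      (fun i : ℕ × FinAut A => (editRel C i.1).ErrorCorrecting i.2.lang) := by
  have hz : PrimrecRel fun (q : ((ℕ × FinAut A) × List A) × List A) (z : List A) =>
      (q.1.2, z) ∈ editRel C q.1.1.1 ∧ (q.2, z) ∈ editRel C q.1.1.1 := by
    have hk : Primrec fun r : (((ℕ × FinAut A) × List A) × List A) × List A => r.1.1.1.1 :=
      Primrec.fst.comp (Primrec.fst.comp (Primrec.fst.comp Primrec.fst))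
    refine PrimrecPred.and ?_ ?_
    · exact (primrecPred_mem_editRel hC.primrecPred).comp (Primrec.pair hk (Primrec.pair
        (Primrec.snd.comp (Primrec.fst.comp Primrec.fst)) Primrec.snd))
    · exact (primrecPred_mem_editRel hC.primrecPred).comp (Primrec.pair hk (Primrec.pair
        (Primrec.snd.comp Primrec.fst) Primrec.snd))
  have hl : Primrec fun q : ((ℕ × FinAut A) × List A) × List A => q.2.length + (q.1.1.1 + 2) :=
    Primrec.nat_add.comp (Primrec.list_length.comp Primrec.snd) (Primrec.nat_add.comp
      (Primrec.fst.comp (Primrec.fst.comp Primrec.fst)) (Primrec.const 2))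
  have hy : PrimrecRel fun (q : (ℕ × FinAut A) × List A) (y : List A) =>
      ¬ ((q.2 ∈ q.1.2.lang ∧ y ∈ q.1.2.lang ∧ q.2 ≠ y) ∧
        ∃ z : List A, z.length < y.length + (q.1.1 + 2) ∧
          (q.2, z) ∈ editRel C q.1.1 ∧ (y, z) ∈ editRel C q.1.1) := by
    refine PrimrecPred.not (PrimrecPred.and (PrimrecPred.and ?_ (PrimrecPred.and ?_ ?_))
      (primrecPred_exists_length_lt hz hl))
    · exact primrecRel_mem_lang.comp (Primrec.fst.comp Primrec.fst) (Primrec.snd.comp Primrec.fst)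
    · exact primrecRel_mem_lang.comp (Primrec.fst.comp Primrec.fst) Primrec.snd
    · exact (Primrec.eq.comp (Primrec.snd.comp Primrec.fst) Primrec.snd).not
  have hx : PrimrecRel fun (i : ℕ × FinAut A) (x : List A) =>
      ∀ y : List A, y.length < i.2.indexBound →
        ¬ ((x ∈ i.2.lang ∧ y ∈ i.2.lang ∧ x ≠ y) ∧
          ∃ z : List A, z.length < y.length + (i.1 + 2) ∧
            (x, z) ∈ editRel C i.1 ∧ (y, z) ∈ editRel C i.1) :=
    primrecPred_forall_length_lt hy (primrec_langIndexBound.comp Primrec.fst)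
  refine DecidableOn.of_primrecPred (primrecPred_forall_length_lt hx primrec_langIndexBound) ?_
  rintro i ⟨-, hfin⟩
  constructor
  · rintro h x hx y hy ⟨z, ⟨x', hx', hxz⟩, ⟨y', hy', hyz⟩⟩
    rw [Set.mem_singleton_iff.1 hx'] at hxz
    rw [Set.mem_singleton_iff.1 hy'] at hyz
    by_contra hne
    have := (hC.length_le hyz).2
    exact h x (i.2.hasIndex_lang.length_lt_of_finite hfin hx) y
      (i.2.hasIndex_lang.length_lt_of_finite hfin hy)
      ⟨⟨hx, hy, hne⟩, z, by omega, hxz, hyz⟩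
  · rintro h x - y - ⟨⟨hx, hy, hne⟩, z, -, hxz, hyz⟩
    exact hne (h x hx y hy ⟨z, ⟨x, rfl, hxz⟩, ⟨y, rfl, hyz⟩⟩)

/-- The algorithm tests independence and completeness; the promise that the language is a code makes
this equivalent to maximality. -/
theorem decidableOn_maximalIndependentCode [Nontrivial A] (hC : IsEditFamily C) :
    DecidableOn FinAut.IsCodeInstance
      (fun i : ℕ × FinAut A => (editRel C i.1).MaximalIndependentCode i.2.lang) :=
  DecidableOn.of_primrecPred (hC.primrecPred_independent.and
    (primrecPred_complete primrecRel_mem_lang primrec_langIndexBound fun i => i.2.hasIndex_lang))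
    fun i hi => (maximalIndependentCode_iff i.2.hasIndex_lang hi.2 (hC.le i.1)).symm

theorem primrecPred_uniquelyDecodable_image (hC : IsEditFamily C) :
    PrimrecPred fun i : ℕ × FinAut A => UniquelyDecodable ((editRel C i.1).image i.2.lang) :=
  primrecPred_uniquelyDecodable hC.primrecRel_mem_image primrec_imageIndexBound hC.hasIndex_image

theorem primrecPred_uniquelyDecodable_reflClosure_image (hC : IsEditFamily C) :
    PrimrecPred fun i : ℕ × FinAut A =>
      UniquelyDecodable ((editRel C i.1).reflClosure.image i.2.lang) := by
  have he : ∀ i : ℕ × FinAut A, (editRel C i.1).reflClosure.image i.2.lang =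
      (editRel C i.1).image i.2.lang ∪ i.2.lang := by
    intro i
    ext w
    constructor
    · rintro ⟨x, hx, h | h⟩
      · exact Or.inl ⟨x, hx, h⟩
      · obtain rfl : x = w := h
        exact Or.inr hx
    · rintro (⟨x, hx, h⟩ | h)
      · exact ⟨x, hx, Or.inl h⟩
      · exact ⟨w, h, Or.inr rfl⟩
  simp only [he]
  exact primrecPred_uniquelyDecodable (PrimrecPred.or hC.primrecRel_mem_image primrecRel_mem_lang)
    (Primrec.nat_mul.comp primrec_imageIndexBound primrec_langIndexBound)
    fun i => (hC.hasIndex_image i).union i.2.hasIndex_lang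

/-- Only the antireflexive part of `τ` has to be an edit relation, which admits `S_1` and `Λ_1`
although they contain diagonal pairs. -/
theorem decidableOn_antirefl (hC : IsEditFamily C) {τ : ℕ → WordRel A}
    (hτ : ∀ k, 1 ≤ k → (τ k).antirefl = editRel C k) :
    DecidableOn FinAut.IsCodeInstance
        (fun i : ℕ × FinAut A => (τ i.1).antirefl.Independent i.2.lang) ∧
      DecidableOn FinAut.IsCodeInstance
        (fun i : ℕ × FinAut A => UniquelyDecodable ((τ i.1).antirefl.image i.2.lang)) :=
  ⟨DecidableOn.of_primrecPred hC.primrecPred_independent fun i hi => by rw [hτ i.1 hi.1],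
    DecidableOn.of_primrecPred hC.primrecPred_uniquelyDecodable_image fun i hi => by
      rw [hτ i.1 hi.1]⟩

/-- Here `τ` is itself antireflexive. Every assertion on finite codes except error correction is
inherited from regular codes by strengthening the promise. -/
theorem decidableOn_all [Nontrivial A] (hC : IsEditFamily C) {τ : ℕ → WordRel A}
    (hτ : ∀ k, 1 ≤ k → τ k = editRel C k) :
    (DecidableOn FinAut.IsFiniteCodeInstance
        (fun i : ℕ × FinAut A => (τ i.1).antirefl.Independent i.2.lang) ∧
      DecidableOn FinAut.IsFiniteCodeInstance
        (fun i : ℕ × FinAut A => (τ i.1).ErrorCorrecting i.2.lang) ∧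
      DecidableOn FinAut.IsFiniteCodeInstance
        (fun i : ℕ × FinAut A => (τ i.1).MaximalIndependentCode i.2.lang) ∧
      DecidableOn FinAut.IsFiniteCodeInstance
        (fun i : ℕ × FinAut A => UniquelyDecodable ((τ i.1).reflClosure.image i.2.lang)) ∧
      DecidableOn FinAut.IsFiniteCodeInstance
        (fun i : ℕ × FinAut A => UniquelyDecodable ((τ i.1).antirefl.image i.2.lang))) ∧
    (DecidableOn FinAut.IsCodeInstance
        (fun i : ℕ × FinAut A => (τ i.1).MaximalIndependentCode i.2.lang) ∧
      DecidableOn FinAut.IsCodeInstance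
        (fun i : ℕ × FinAut A => UniquelyDecodable ((τ i.1).reflClosure.image i.2.lang))) := by
  have h := hC.decidableOn_antirefl (τ := τ) fun k hk => by
    rw [hτ k hk, WordRel.antirefl_editRel]
  have hmax : DecidableOn FinAut.IsCodeInstance
      (fun i : ℕ × FinAut A => (τ i.1).MaximalIndependentCode i.2.lang) :=
    hC.decidableOn_maximalIndependentCode.congr (fun _ hi => hi) fun i hi => by
      rw [hτ i.1 hi.1]
  have hrefl : DecidableOn FinAut.IsCodeInstance
      (fun i : ℕ × FinAut A => UniquelyDecodable ((τ i.1).reflClosure.image i.2.lang)) :=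
    DecidableOn.of_primrecPred hC.primrecPred_uniquelyDecodable_reflClosure_image fun i hi => by
      rw [hτ i.1 hi.1]
  refine ⟨⟨h.1.congr (fun _ hi => hi.1) fun _ _ => Iff.rfl,
    hC.decidableOn_errorCorrecting.congr (fun _ hi => hi) fun i hi => by rw [hτ i.1 hi.1.1],
    hmax.congr (fun _ hi => hi.1) fun _ _ => Iff.rfl,
    hrefl.congr (fun _ hi => hi.1) fun _ _ => Iff.rfl,
    h.2.congr (fun _ hi => hi.1) fun _ _ => Iff.rfl⟩, hmax, hrefl⟩

end IsEditFamily

/-! ### The seven concrete families. -/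

section Families

variable {α : Type*} [Primcodable α]

theorem primrecPred_nat_eq {f g : α → ℕ} (hf : Primrec f) (hg : Primrec g) :
    PrimrecPred fun a => f a = g a := Primrec.eq.comp hf hg

theorem primrecPred_nat_le {f g : α → ℕ} (hf : Primrec f) (hg : Primrec g) :
    PrimrecPred fun a => f a ≤ g a := Primrec.nat_le.comp hf hg

theorem primrec_budget : Primrec fun q : ℕ × ℕ × ℕ × ℕ => q.1 := Primrec.fst

theorem primrec_deletions : Primrec fun q : ℕ × ℕ × ℕ × ℕ => q.2.1 :=
  Primrec.fst.comp Primrec.snd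

theorem primrec_insertions : Primrec fun q : ℕ × ℕ × ℕ × ℕ => q.2.2.1 :=
  Primrec.fst.comp (Primrec.snd.comp Primrec.snd)

theorem primrec_substitutions : Primrec fun q : ℕ × ℕ × ℕ × ℕ => q.2.2.2 :=
  Primrec.snd.comp (Primrec.snd.comp Primrec.snd)

theorem isEditFamily_del : IsEditFamily fun k d i s => d = k ∧ i = 0 ∧ s = 0 where
  primrecPred := (primrecPred_nat_eq primrec_deletions primrec_budget).and
    ((primrecPred_nat_eq primrec_insertions (Primrec.const 0)).and
      (primrecPred_nat_eq primrec_substitutions (Primrec.const 0)))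
  le := by intros; omega

theorem isEditFamily_ins : IsEditFamily fun k d i s => d = 0 ∧ i = k ∧ s = 0 where
  primrecPred := (primrecPred_nat_eq primrec_deletions (Primrec.const 0)).and
    ((primrecPred_nat_eq primrec_insertions primrec_budget).and
      (primrecPred_nat_eq primrec_substitutions (Primrec.const 0)))
  le := by intros; omega

theorem isEditFamily_sub : IsEditFamily fun k d i s => d = 0 ∧ i = 0 ∧ s = k where
  primrecPred := (primrecPred_nat_eq primrec_deletions (Primrec.const 0)).and
    ((primrecPred_nat_eq primrec_insertions (Primrec.const 0)).and
      (primrecPred_nat_eq primrec_substitutions primrec_budget))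
  le := by intros; omega

theorem isEditFamily_delUpTo :
    IsEditFamily fun k d i s => (1 ≤ d ∧ d ≤ k) ∧ i = 0 ∧ s = 0 where
  primrecPred := ((primrecPred_nat_le (Primrec.const 1) primrec_deletions).and
    (primrecPred_nat_le primrec_deletions primrec_budget)).and
    ((primrecPred_nat_eq primrec_insertions (Primrec.const 0)).and
      (primrecPred_nat_eq primrec_substitutions (Primrec.const 0)))
  le := by intros; omega

theorem isEditFamily_insUpTo :
    IsEditFamily fun k d i s => d = 0 ∧ (1 ≤ i ∧ i ≤ k) ∧ s = 0 where
  primrecPred := (primrecPred_nat_eq primrec_deletions (Primrec.const 0)).and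
    (((primrecPred_nat_le (Primrec.const 1) primrec_insertions).and
      (primrecPred_nat_le primrec_insertions primrec_budget)).and
      (primrecPred_nat_eq primrec_substitutions (Primrec.const 0)))
  le := by intros; omega

/-- The budget `b` is the identity for S_k and constantly 1 for S_1. The constant exceeds `k` at `k
= 0`, hence the slack `k + 1`. -/
theorem isEditFamily_indel {b : ℕ → ℕ} (hb : Primrec b) (hle : ∀ k, b k ≤ k + 1) :
    IsEditFamily fun k d i s => d + i ≤ b k ∧ s = 0 where
  primrecPred := (primrecPred_nat_le (Primrec.nat_add.comp primrec_deletions primrec_insertions)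
    (hb.comp primrec_budget)).and (primrecPred_nat_eq primrec_substitutions (Primrec.const 0))
  le := by
    intro k d i s h
    have := hle k
    omega

theorem isEditFamily_lev {b : ℕ → ℕ} (hb : Primrec b) (hle : ∀ k, b k ≤ k + 1) :
    IsEditFamily fun k d i s => d + i + s ≤ b k where
  primrecPred := primrecPred_nat_le (Primrec.nat_add.comp
    (Primrec.nat_add.comp primrec_deletions primrec_insertions) primrec_substitutions)
    (hb.comp primrec_budget)
  le := by
    intro k d i s h
    have := hle k
    omega

end Families

end EditCodes

theorem mainTheorem11 (A : Type*) [Finite A] [Nontrivial A] [Primcodable A] :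
    (∀ τ ∈ ({WordRel.del, WordRel.ins, WordRel.sub, WordRel.delUpTo, WordRel.insUpTo,
          fun k => (WordRel.indel k).antirefl, fun k => (WordRel.lev k).antirefl} :
          Set (ℕ → WordRel A)),
      -- (i) finite codes
      (DecidableOn FinAut.IsFiniteCodeInstance
          (fun i : ℕ × FinAut A => (τ i.1).antirefl.Independent i.2.lang) ∧
        DecidableOn FinAut.IsFiniteCodeInstance
          (fun i : ℕ × FinAut A => (τ i.1).ErrorCorrecting i.2.lang) ∧
        DecidableOn FinAut.IsFiniteCodeInstance
          (fun i : ℕ × FinAut A => (τ i.1).MaximalIndependentCode i.2.lang) ∧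
        DecidableOn FinAut.IsFiniteCodeInstance
          (fun i : ℕ × FinAut A => UniquelyDecodable ((τ i.1).reflClosure.image i.2.lang)) ∧
        DecidableOn FinAut.IsFiniteCodeInstance
          (fun i : ℕ × FinAut A => UniquelyDecodable ((τ i.1).antirefl.image i.2.lang))) ∧
      -- (ii) regular codes
      (DecidableOn FinAut.IsCodeInstance
          (fun i : ℕ × FinAut A => (τ i.1).MaximalIndependentCode i.2.lang) ∧
        DecidableOn FinAut.IsCodeInstance
          (fun i : ℕ × FinAut A => UniquelyDecodable ((τ i.1).reflClosure.image i.2.lang)))) ∧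
    -- (iii) regular codes, with `S_k` and `Λ_k` for `k = 1` only
    (∀ τ ∈ ({WordRel.del, WordRel.ins, WordRel.sub, WordRel.delUpTo, WordRel.insUpTo,
          fun _ => WordRel.indel 1, fun _ => WordRel.lev 1} : Set (ℕ → WordRel A)),
      DecidableOn FinAut.IsCodeInstance
          (fun i : ℕ × FinAut A => (τ i.1).antirefl.Independent i.2.lang) ∧
        DecidableOn FinAut.IsCodeInstance
          (fun i : ℕ × FinAut A => UniquelyDecodable ((τ i.1).antirefl.image i.2.lang))) := by
  constructor
  · rintro τ (rfl | rfl | rfl | rfl | rfl | rfl | rfl)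
    · exact isEditFamily_del.decidableOn_all fun _ hk => WordRel.del_eq_editRel hk
    · exact isEditFamily_ins.decidableOn_all fun _ hk => WordRel.ins_eq_editRel hk
    · exact isEditFamily_sub.decidableOn_all fun _ hk => WordRel.sub_eq_editRel hk
    · exact isEditFamily_delUpTo.decidableOn_all fun k _ => WordRel.delUpTo_eq_editRel k
    · exact isEditFamily_insUpTo.decidableOn_all fun k _ => WordRel.insUpTo_eq_editRel k
    · exact (isEditFamily_indel Primrec.id fun k => k.le_succ).decidableOn_all
        fun k _ => WordRel.antirefl_indel_eq_editRel k
    · exact (isEditFamily_lev Primrec.id fun k => k.le_succ).decidableOn_all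
        fun k _ => WordRel.antirefl_lev_eq_editRel k
  · rintro τ (rfl | rfl | rfl | rfl | rfl | rfl | rfl)
    · exact isEditFamily_del.decidableOn_antirefl fun _ hk => by
        rw [WordRel.del_eq_editRel hk, WordRel.antirefl_editRel]
    · exact isEditFamily_ins.decidableOn_antirefl fun _ hk => by
        rw [WordRel.ins_eq_editRel hk, WordRel.antirefl_editRel]
    · exact isEditFamily_sub.decidableOn_antirefl fun _ hk => by
        rw [WordRel.sub_eq_editRel hk, WordRel.antirefl_editRel]
    · exact isEditFamily_delUpTo.decidableOn_antirefl fun k _ => by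
        rw [WordRel.delUpTo_eq_editRel, WordRel.antirefl_editRel]
    · exact isEditFamily_insUpTo.decidableOn_antirefl fun k _ => by
        rw [WordRel.insUpTo_eq_editRel, WordRel.antirefl_editRel]
    · exact (isEditFamily_indel (Primrec.const 1) fun k => by omega).decidableOn_antirefl
        fun _ _ => WordRel.antirefl_indel_eq_editRel 1
    · exact (isEditFamily_lev (Primrec.const 1) fun k => by omega).decidableOn_antirefl
        fun _ _ => WordRel.antirefl_lev_eq_editRel 1
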